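/- Let $\mathbb{H}_2$ be the Siegel half-space of symmetric matrices $Z=\begin{pmatrix}\tau&z\\z&\tau'\end{pmatrix}\in\mathbb{C}^{2\times2}$ with $\operatorname{Im}Z>0$. For $f:\mathbb{H}_2\to\mathbb{C}$, $k\in\mathbb{Z}$ and $M=\begin{pmatrix}A&B\\C&D\end{pmatrix}\in\operatorname{Sp}_2(\mathbb{R})$ (the real symplectic group of $4\times4$ matrices) put $$(f|_kM)(Z)=\det(CZ+D)^{-k}f\bigl((AZ+B)(CZ+D)^{-1}\bigr).$$ For $N\in\mathbb{N}$ let $\Sigma_N$ be the paramodular group, $\Sigma_N^J$ the Jacobi group and $\Gamma_N$ the translation group, $$\Sigma_N=\left\{\begin{pmatrix}*&*N&*&*\\ *&*&*&*/N\\ *&*N&*&*\\ *N&*N&*N&*\end{pmatrix}\in\operatorname{Sp}_2(\mathbb{Q});\ *\in\mathbb{Z}\right\},\quad \Sigma_N^J=\left\{\begin{pmatrix}*&0&*&*\\ *&\pm1&*&*/N\\ *&0&*&*\\0&0&0&\pm1\end{pmatrix}\in\Sigma_N\right\},\quad \Gamma_N=\left\{\begin{pmatrix}I&*\\0&I\end{pmatrix}\in\Sigma_N\right\}.$$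 Let $k\ge4$ be even, $N\in\mathbb{N}$ squarefree and $q$ a prime with $q\nmid N$. Let the Jacobi Eisenstein series be $$e^*_{k,N}(Z)=\tfrac14\sum_{M:\Gamma_N\backslash\Sigma_N^J}(\phi_N|_kM)(Z),\qquad \phi_N(Z)=e^{2\pi iN\tau'},$$ and let $K=\tfrac1q\operatorname{diag}(1,q,q^2,q)$. Then the series $e^*_{k,N}$ converges absolutely at every $Z\in\mathbb{H}_2$, it is invariant under $|_kM$ for all $M\in\Sigma_N^J$, it is not identically zero, the set $\Sigma_N^J\backslash\Sigma_N^JK\Sigma_N^J$ is finite, and $e^*_{k,N}$ is an eigenfunction of the Hecke operator given by the double coset of $K$ (without normalizing factors) with eigenvalue $q^k+q^{3-k}$: $$e^*_{k,N}\,|_k\,\Sigma_N^JK\Sigma_N^J:=\sum_{L:\Sigma_N^J\backslash\Sigma_N^JK\Sigma_N^J}e^*_{k,N}|_kL=(q^k+q^{3-k})\,e^*_{k,N}\quad\text{on }\mathbb{H}_2.$$ -/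

import Mathlib

open Matrix

noncomputable section

namespace Paramodular

/-- The real symplectic group of degree two. Rows and columns are indexed by `Fin 2 ⊕ Fin 2`:
the indices `1, 2, 3, 4` of a `4 × 4` matrix are `inl 0, inl 1, inr 0, inr 1`. -/
abbrev Sp2 : Type := symplecticGroup (Fin 2) ℝ

/-- The Siegel upper half-space of degree two: symmetric complex `2 × 2` matrices whose
imaginary part is positive definite. -/
def siegelHalfSpace : Set (Matrix (Fin 2) (Fin 2) ℂ) :=
  {Z | Z.IsSymm ∧ (Z.map Complex.im).PosDef}

/-- The upper left block `A` of a symplectic matrix, with complex entries. -/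
def blockA (M : Sp2) : Matrix (Fin 2) (Fin 2) ℂ := M.1.toBlocks₁₁.map (fun x : ℝ => (x : ℂ))

/-- The upper right block `B` of a symplectic matrix, with complex entries. -/
def blockB (M : Sp2) : Matrix (Fin 2) (Fin 2) ℂ := M.1.toBlocks₁₂.map (fun x : ℝ => (x : ℂ))

/-- The lower left block `C` of a symplectic matrix, with complex entries. -/
def blockC (M : Sp2) : Matrix (Fin 2) (Fin 2) ℂ := M.1.toBlocks₂₁.map (fun x : ℝ => (x : ℂ))

/-- The lower right block `D` of a symplectic matrix, with complex entries. -/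
def blockD (M : Sp2) : Matrix (Fin 2) (Fin 2) ℂ := M.1.toBlocks₂₂.map (fun x : ℝ => (x : ℂ))

/-- The action `M⟨Z⟩ = (A Z + B) (C Z + D)⁻¹`. -/
def moebius (M : Sp2) (Z : Matrix (Fin 2) (Fin 2) ℂ) : Matrix (Fin 2) (Fin 2) ℂ :=
  (blockA M * Z + blockB M) * (blockC M * Z + blockD M)⁻¹

/-- The weight `k` action `(f ∣ₖ M)(Z) = det (C Z + D)^(-k) f(M⟨Z⟩)`. -/
def slash (k : ℤ) (f : Matrix (Fin 2) (Fin 2) ℂ → ℂ) (M : Sp2)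
    (Z : Matrix (Fin 2) (Fin 2) ℂ) : ℂ :=
  (blockC M * Z + blockD M).det ^ (-k) * f (moebius M Z)

/-- The entry in position `(i, j)` of an element of the paramodular group of level `N` is an
integral multiple of `scale N i j`. -/
def scale (N : ℕ) : Matrix (Fin 2 ⊕ Fin 2) (Fin 2 ⊕ Fin 2) ℝ :=
  fromBlocks
    !![1, (N : ℝ); 1, 1] !![1, 1; 1, 1 / (N : ℝ)]
    !![1, (N : ℝ); (N : ℝ), (N : ℝ)] !![1, 1; (N : ℝ), 1]

theorem scale_mul (N : ℕ) [NeZero N] (i j l : Fin 2 ⊕ Fin 2) :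
    ∃ c : ℤ, scale N i j * scale N j l = scale N i l * c := by
  have hN : (N : ℝ) ≠ 0 := Nat.cast_ne_zero.2 (NeZero.ne N)
  rcases i with i | i <;> rcases j with j | j <;> rcases l with l | l <;>
    fin_cases i <;> fin_cases j <;> fin_cases l <;>
    first
    | (refine ⟨1, ?_⟩; simp [scale, hN]; done)
    | (refine ⟨N, ?_⟩; simp [scale, hN])

theorem coe_inv_apply (M : Sp2) : ((M⁻¹ : Sp2) : Matrix (Fin 2 ⊕ Fin 2) (Fin 2 ⊕ Fin 2) ℝ) =
    fromBlocks (M.1.toBlocks₂₂)ᵀ (-(M.1.toBlocks₁₂)ᵀ) (-(M.1.toBlocks₂₁)ᵀ) (M.1.toBlocks₁₁)ᵀ := by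
  rw [SymplecticGroup.coe_inv]
  conv_lhs => rw [← fromBlocks_toBlocks M.1]
  simp [J, fromBlocks_transpose, fromBlocks_multiply, fromBlocks_neg]

/-- The paramodular group of degree two and level `N`. -/
def paramodularGroup (N : ℕ) [NeZero N] : Subgroup Sp2 where
  carrier := {M | ∀ i j, ∃ n : ℤ, M.1 i j = scale N i j * n}
  one_mem' := by
    intro i j
    by_cases h : i = j
    · subst h
      refine ⟨1, ?_⟩
      rcases i with i | i <;> fin_cases i <;> simp [scale]
    · exact ⟨0, by simp [h]⟩
  mul_mem' := by
    intro M M' hM hM' i j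
    choose a ha using hM
    choose b hb using hM'
    choose c hc using fun l => scale_mul N i l j
    refine ⟨∑ l, c l * a i l * b l j, ?_⟩
    change (M.1 * M'.1) i j = _
    rw [Matrix.mul_apply, Int.cast_sum, Finset.mul_sum]
    refine Finset.sum_congr rfl fun l _ => ?_
    rw [ha, hb]
    push_cast
    linear_combination (a i l * b l j : ℝ) * hc l
  inv_mem' := by
    intro M hM i j
    have h : ∃ e : ℤ, (M⁻¹ : Sp2).1 i j = e * M.1 j.swap i.swap := by
      rw [coe_inv_apply]
      rcases i with i | i <;> rcases j with j | j
      · exact ⟨1, by simp [toBlocks₂₂]⟩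
      · exact ⟨-1, by simp [toBlocks₁₂]⟩
      · exact ⟨-1, by simp [toBlocks₂₁]⟩
      · exact ⟨1, by simp [toBlocks₁₁]⟩
    have hs : scale N j.swap i.swap = scale N i j := by
      rcases i with i | i <;> rcases j with j | j <;> fin_cases i <;> fin_cases j <;> simp [scale]
    obtain ⟨e, he⟩ := h
    obtain ⟨a, ha⟩ := hM j.swap i.swap
    refine ⟨e * a, ?_⟩
    rw [he, ha, hs]
    push_cast
    ring

/-- The Jacobi group inside the paramodular group of level `N`: the elements of the shape
`(* 0 * * ; * ±1 * */N ; * 0 * * ; 0 0 0 ±1)`. -/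
def jacobiGroup (N : ℕ) [NeZero N] : Subgroup Sp2 where
  carrier := {M | M ∈ paramodularGroup N ∧
    M.1 (.inl 0) (.inl 1) = 0 ∧ M.1 (.inr 0) (.inl 1) = 0 ∧
    M.1 (.inr 1) (.inl 0) = 0 ∧ M.1 (.inr 1) (.inl 1) = 0 ∧ M.1 (.inr 1) (.inr 0) = 0 ∧
    (M.1 (.inl 1) (.inl 1) = 1 ∨ M.1 (.inl 1) (.inl 1) = -1) ∧
    (M.1 (.inr 1) (.inr 1) = 1 ∨ M.1 (.inr 1) (.inr 1) = -1)}
  one_mem' := ⟨one_mem _, by simp⟩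
  mul_mem' := by
    rintro M M' ⟨hM, h1, h2, h3, h4, h5, h6, h7⟩ ⟨hM', h1', h2', h3', h4', h5', h6', h7'⟩
    refine ⟨mul_mem hM hM', ?_⟩
    simp only [Submonoid.coe_mul, Matrix.mul_apply, Fintype.sum_sum_type, Fin.sum_univ_two,
      h1, h2, h3, h4, h5, h1', h2', h3', h4', h5']
    rcases h6 with h6 | h6 <;> rcases h7 with h7 | h7 <;> rcases h6' with h6' | h6' <;>
      rcases h7' with h7' | h7' <;> simp [h6, h7, h6', h7']
  inv_mem' := by
    rintro M ⟨hM, h1, h2, h3, h4, h5, h6, h7⟩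
    refine ⟨inv_mem hM, ?_⟩
    rw [coe_inv_apply]
    simp [toBlocks₁₁, toBlocks₁₂, toBlocks₂₁, toBlocks₂₂, h1, h2, h3, h4, h5, h6, h7]

/-- The translation group: the elements `(I * ; 0 I)` of the paramodular group of level `N`. -/
def translationGroup (N : ℕ) [NeZero N] : Subgroup Sp2 where
  carrier := {M | M ∈ paramodularGroup N ∧
    M.1.toBlocks₁₁ = 1 ∧ M.1.toBlocks₂₁ = 0 ∧ M.1.toBlocks₂₂ = 1}
  one_mem' := by
    refine ⟨one_mem _, ?_⟩
    have h : ((1 : Sp2) : Matrix (Fin 2 ⊕ Fin 2) (Fin 2 ⊕ Fin 2) ℝ) = fromBlocks 1 0 0 1 :=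
      fromBlocks_one.symm
    rw [h]
    exact ⟨toBlocks_fromBlocks₁₁ .., toBlocks_fromBlocks₂₁ .., toBlocks_fromBlocks₂₂ ..⟩
  mul_mem' := by
    rintro M M' ⟨hM, h1, h2, h3⟩ ⟨hM', h1', h2', h3'⟩
    refine ⟨mul_mem hM hM', ?_⟩
    have h : (M * M').1 = fromBlocks 1 (M'.1.toBlocks₁₂ + M.1.toBlocks₁₂) 0 1 := by
      change M.1 * M'.1 = _
      rw [← fromBlocks_toBlocks M.1, ← fromBlocks_toBlocks M'.1, h1, h2, h3, h1', h2', h3']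
      simp [fromBlocks_multiply]
    rw [h]
    simp
  inv_mem' := by
    rintro M ⟨hM, h1, h2, h3⟩
    refine ⟨inv_mem hM, ?_⟩
    rw [coe_inv_apply]
    simp [h1, h2, h3]

/-- The space `Γ \ S` of cosets `Γ L` with `L ∈ S`, for a set `S` with `Γ S = S`. -/
abbrev CosetSpace (Γ : Subgroup Sp2) (S : Set Sp2) : Type :=
  Quotient ((QuotientGroup.rightRel Γ).comap (Subtype.val : S → Sp2))

/-- A representative in `S` of a coset in `Γ \ S`. -/
def CosetSpace.rep {Γ : Subgroup Sp2} {S : Set Sp2} (c : CosetSpace Γ S) : Sp2 :=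
  (Quotient.out c).1

/-- The double coset `Γ M Γ`. -/
abbrev doubleCoset (Γ : Subgroup Sp2) (M : Sp2) : Set Sp2 := DoubleCoset.doubleCoset M Γ Γ

/-- The Hecke operator `f ∣ₖ Γ M Γ = ∑ f ∣ₖ L`, where `L` runs over representatives of
`Γ \ Γ M Γ`, without any normalizing factor. It is meant for `f` invariant under `Γ` and finite
`Γ \ Γ M Γ`. -/
def heckeOperator (k : ℤ) (Γ : Subgroup Sp2) (M : Sp2) (f : Matrix (Fin 2) (Fin 2) ℂ → ℂ)
    (Z : Matrix (Fin 2) (Fin 2) ℂ) : ℂ :=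
  ∑ᶠ c : CosetSpace Γ (doubleCoset Γ M), slash k f c.rep Z

/-- The function `φ_N(Z) = exp(2πiNτ')`, where `τ'` is the lower right entry of `Z`. -/
def phi (N : ℕ) (Z : Matrix (Fin 2) (Fin 2) ℂ) : ℂ :=
  Complex.exp (2 * Real.pi * Complex.I * N * Z 1 1)

/-- The Jacobi Eisenstein series of weight `k` and index `N`. -/
def jacobiEisenstein (k : ℤ) (N : ℕ) [NeZero N] (Z : Matrix (Fin 2) (Fin 2) ℂ) : ℂ :=
  (1 / 4) * ∑' c : CosetSpace (translationGroup N) (jacobiGroup N), slash k (phi N) c.rep Z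

/-- The symplectic matrix `(1/q) diag(1, q, q², q)`. -/
def heckeMatrix (q : ℕ) (hq : q ≠ 0) : Sp2 :=
  ⟨(1 / (q : ℝ)) • fromBlocks (diagonal ![1, (q : ℝ)]) 0 0 (diagonal ![(q : ℝ) ^ 2, (q : ℝ)]), by
    have h : (q : ℝ) ≠ 0 := Nat.cast_ne_zero.2 hq
    rw [SymplecticGroup.mem_iff]
    ext i j
    rcases i with i | i <;> rcases j with j | j <;> fin_cases i <;> fin_cases j <;>
      simp [J, h] <;>
      field_simp⟩

end Paramodular

end

open Paramodular

/-! Write Γ for the translation group and J for the Jacobi group. The series is 1/4 of the sum of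
φ_N|M over Γ\J, and everything is read off from explicit cosets. An element of the real Jacobi group
is a matrix (a b; c d) in SL₂ together with a Heisenberg part (l, m), κ and a sign ε. Modulo Γ on
the left, an integral one is determined by ε, the coprime row (c, d) and the integer r = ld - mc
(`isTransversal_cosetElt`).

Convergence: completing the square (`exponent_eq`) shows that each term has size const · |cτ+d|^(-k)
· exp(-2πN Im τ · (r + shift)² / |cτ+d|²). Part of the decay in |cτ+d| is traded for decay in r, and
k ≥ 4 leaves enough to sum over (c, d). The same bound is uniform along diag(iy, i), y ≥ 1. As y → ∞
only the terms with c = r = 0 survive, and they do not cancel since k is even; so the series is not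
zero.

Eigenvalue: the cosets Γ\JKJ are listed in two ways. As (Γ\J)·(J\JKJ) they turn the sum of φ_N|L
into the Hecke operator applied to the series. As R·(Γ\J), with R in the finite list `heckeRep`,
they let R act on φ_N first (`heckeOperator_jacobiEisenstein`). Every R has c = 0, so φ_N|R is
explicit. The three families in the list correspond to gcd(c, q²) = 1, q, q²: the dilation
contributes q^k; the unipotent elements contribute the sum of e(N l² s/q) over l mod q and s = 1, …,
q-1, which is 0 (`sum_unip_eq_zero`); the contractions contribute a sum over s mod q² that kills all
l ≠ 0 because q ∤ N, leaving q³ equal terms q^(-k) (`sum_contraction`). -/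

noncomputable section

namespace Paramodular

/-! ### Coordinates on the Jacobi group -/

/-- Coordinates on the real Jacobi group: an element of `SL₂(ℝ)`, a vector `(l, m)`, a central
coordinate and a sign. -/
@[ext] structure JacobiElt where
  a : ℝ
  b : ℝ
  c : ℝ
  d : ℝ
  l : ℝ
  m : ℝ
  κ : ℝ
  ε : ℝ
  det : a * d - b * c = 1
  sq : ε * ε = 1

namespace JacobiElt

/-- The symplectic matrix with the given Jacobi coordinates. -/
def toSp2 (P : JacobiElt) : Sp2 :=
  ⟨fromBlocks !![P.a, 0; P.l, P.ε] !![P.b, P.ε * (P.a * P.m - P.b * P.l); P.m, P.κ]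
    !![P.c, 0; 0, 0] !![P.d, P.ε * (P.c * P.m - P.d * P.l); 0, P.ε], by
    have h1 := P.det
    have h2 := P.sq
    rw [SymplecticGroup.mem_iff]
    ext i j
    rcases i with i | i <;> rcases j with j | j <;> fin_cases i <;> fin_cases j <;>
      simp [J, Matrix.mul_apply, Fin.sum_univ_two] <;> grind⟩

instance : Mul JacobiElt where
  mul P Q :=
    { a := P.a * Q.a + P.b * Q.c
      b := P.a * Q.b + P.b * Q.d
      c := P.c * Q.a + P.d * Q.c
      d := P.c * Q.b + P.d * Q.d
      l := P.l * Q.a + P.m * Q.c + P.ε * Q.l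
      m := P.l * Q.b + P.m * Q.d + P.ε * Q.m
      κ := P.l * (Q.ε * (Q.a * Q.m - Q.b * Q.l)) + P.m * (Q.ε * (Q.c * Q.m - Q.d * Q.l)) +
        P.ε * Q.κ + P.κ * Q.ε
      ε := P.ε * Q.ε
      det := by linear_combination (Q.a * Q.d - Q.b * Q.c) * P.det + Q.det
      sq := by linear_combination Q.ε * Q.ε * P.sq + Q.sq }

theorem mul_def (P Q : JacobiElt) : P * Q =
    { a := P.a * Q.a + P.b * Q.c
      b := P.a * Q.b + P.b * Q.d
      c := P.c * Q.a + P.d * Q.c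
      d := P.c * Q.b + P.d * Q.d
      l := P.l * Q.a + P.m * Q.c + P.ε * Q.l
      m := P.l * Q.b + P.m * Q.d + P.ε * Q.m
      κ := P.l * (Q.ε * (Q.a * Q.m - Q.b * Q.l)) + P.m * (Q.ε * (Q.c * Q.m - Q.d * Q.l)) +
        P.ε * Q.κ + P.κ * Q.ε
      ε := P.ε * Q.ε
      det := by linear_combination (Q.a * Q.d - Q.b * Q.c) * P.det + Q.det
      sq := by linear_combination Q.ε * Q.ε * P.sq + Q.sq } := rfl

theorem toSp2_mul (P Q : JacobiElt) : (P * Q).toSp2 = P.toSp2 * Q.toSp2 := by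
  have h1 := P.det
  have h2 := P.sq
  have h3 := Q.sq
  have h4 := Q.det
  apply Subtype.ext
  change _ = P.toSp2.1 * Q.toSp2.1
  ext i j
  rcases i with i | i <;> rcases j with j | j <;> fin_cases i <;> fin_cases j <;>
    simp [toSp2, mul_def, Matrix.mul_apply, Fin.sum_univ_two] <;> grind

theorem toSp2_injective : Function.Injective toSp2 := by
  intro P Q h
  have h' : P.toSp2.1 = Q.toSp2.1 := by rw [h]
  simp only [toSp2, fromBlocks_inj] at h'
  obtain ⟨h1, h2, h3, h4⟩ := h'
  ext
  · simpa using congrFun (congrFun h1 0) 0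
  · simpa using congrFun (congrFun h2 0) 0
  · simpa using congrFun (congrFun h3 0) 0
  · simpa using congrFun (congrFun h4 0) 0
  · simpa using congrFun (congrFun h1 1) 0
  · simpa using congrFun (congrFun h2 1) 0
  · simpa using congrFun (congrFun h2 1) 1
  · simpa using congrFun (congrFun h1 1) 1

/-- Jacobi coordinates of an element of the integral Jacobi group of level `N`. -/
def ofInt (N : ℕ) (a b c d l m κ : ℤ) (ε : ℤˣ) (h : a * d - b * c = 1) : JacobiElt where
  a := a
  b := b
  c := c
  d := d
  l := l
  m := m
  κ := κ / N
  ε := (ε : ℤ)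
  det := by exact_mod_cast h
  sq := by exact_mod_cast Int.units_coe_mul_self ε

/-- The translation by the symmetric matrix `(s t; t u)`. -/
def transl (s t u : ℝ) : JacobiElt where
  a := 1
  b := s
  c := 0
  d := 1
  l := 0
  m := t
  κ := u
  ε := 1
  det := by simp
  sq := by simp

/-- The Heisenberg element with first coordinate `l`. -/
def heis (l : ℝ) : JacobiElt where
  a := 1
  b := 0
  c := 0
  d := 1
  l := l
  m := 0
  κ := 0
  ε := 1
  det := by simp
  sq := by simp

/-- The diagonal element `diag(t, 1, t⁻¹, 1)`. -/
def dil (t : ℝ) (ht : t ≠ 0) : JacobiElt where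
  a := t
  b := 0
  c := 0
  d := t⁻¹
  l := 0
  m := 0
  κ := 0
  ε := 1
  det := by simp [ht]
  sq := by simp

end JacobiElt

open JacobiElt

/-! ### The integral Jacobi and translation groups in coordinates -/

/-- The symplectic relations force determinant 1, equality of the two signs, and the two upper
entries of the last kind of column from the rest; only κ keeps the denominator N. -/
theorem mem_jacobiGroup_iff {N : ℕ} [NeZero N] {M : Sp2} : M ∈ jacobiGroup N ↔
    ∃ (a b c d l m κ : ℤ) (ε : ℤˣ) (h : a * d - b * c = 1),
      M = (ofInt N a b c d l m κ ε h).toSp2 := by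
  constructor
  · rintro ⟨hM, h1, h2, h3, h4, h5, h6, h7⟩
    obtain ⟨a, ha⟩ := hM (.inl 0) (.inl 0)
    obtain ⟨b, hb⟩ := hM (.inl 0) (.inr 0)
    obtain ⟨c, hc⟩ := hM (.inr 0) (.inl 0)
    obtain ⟨d, hd⟩ := hM (.inr 0) (.inr 0)
    obtain ⟨l, hl⟩ := hM (.inl 1) (.inl 0)
    obtain ⟨m, hm⟩ := hM (.inl 1) (.inr 0)
    obtain ⟨κ, hκ⟩ := hM (.inl 1) (.inr 1)
    have key := (SymplecticGroup.mem_iff).1 M.2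
    have k13 := congrFun (congrFun key (.inl 0)) (.inr 0)
    have k24 := congrFun (congrFun key (.inl 1)) (.inr 1)
    have k12 := congrFun (congrFun key (.inl 0)) (.inl 1)
    have k32 := congrFun (congrFun key (.inr 0)) (.inl 1)
    simp [Matrix.mul_apply, J, Fintype.sum_sum_type, Fin.sum_univ_two, h1, h2, h3, h4, h5,
      Matrix.one_apply] at k13 k24 k12 k32
    simp [scale] at ha hb hc hd hl hm hκ
    rw [ha, hb, hc, hd] at k13
    obtain ⟨ε, hε⟩ : ∃ ε : ℤˣ, M.1 (.inl 1) (.inl 1) = ((ε : ℤ) : ℝ) := by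
      rcases h6 with h | h
      · exact ⟨1, by simp [h]⟩
      · exact ⟨-1, by simp [h]⟩
    have hs : ((ε : ℤ) : ℝ) * (ε : ℤ) = 1 := by exact_mod_cast Int.units_coe_mul_self ε
    have hε' : M.1 (.inr 1) (.inr 1) = ((ε : ℤ) : ℝ) := by
      rw [hε] at k24
      linear_combination ((ε : ℤ) : ℝ) * k24 - M.1 (.inr 1) (.inr 1) * hs
    rw [ha, hb, hl, hm, hε] at k12
    rw [hc, hd, hl, hm, hε] at k32
    have hx : M.1 (.inl 0) (.inr 1) = (ε : ℤ) * (a * m - b * l : ℝ) := by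
      linear_combination -M.1 (.inl 0) (.inr 1) * hs + ((ε : ℤ) : ℝ) * k12
    have hy : M.1 (.inr 0) (.inr 1) = (ε : ℤ) * (c * m - d * l : ℝ) := by
      linear_combination -M.1 (.inr 0) (.inr 1) * hs + ((ε : ℤ) : ℝ) * k32
    refine ⟨a, b, c, d, l, m, κ, ε, ?_, ?_⟩
    · have : (a * d - b * c : ℝ) = 1 := by linear_combination -k13
      exact_mod_cast this
    · apply Subtype.ext
      ext i j
      rcases i with i | i <;> rcases j with j | j <;> fin_cases i <;> fin_cases j <;>
        simp [toSp2, ofInt, *] <;> ring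
  · rintro ⟨a, b, c, d, l, m, κ, ε, h, rfl⟩
    refine ⟨?_, ?_⟩
    · have hN : (N : ℝ) ≠ 0 := Nat.cast_ne_zero.2 (NeZero.ne N)
      intro i j
      rcases i with i | i <;> rcases j with j | j <;> fin_cases i <;> fin_cases j
      · exact ⟨a, by simp [toSp2, ofInt, scale]⟩
      · exact ⟨0, by simp [toSp2, ofInt, scale]⟩
      · exact ⟨l, by simp [toSp2, ofInt, scale]⟩
      · exact ⟨ε, by simp [toSp2, ofInt, scale]⟩
      · exact ⟨b, by simp [toSp2, ofInt, scale]⟩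
      · exact ⟨ε * (a * m - b * l), by simp [toSp2, ofInt, scale]⟩
      · exact ⟨m, by simp [toSp2, ofInt, scale]⟩
      · exact ⟨κ, by simp [toSp2, ofInt, scale]; ring⟩
      · exact ⟨c, by simp [toSp2, ofInt, scale]⟩
      · exact ⟨0, by simp [toSp2, ofInt, scale]⟩
      · exact ⟨0, by simp [toSp2, ofInt, scale]⟩
      · exact ⟨0, by simp [toSp2, ofInt, scale]⟩
      · exact ⟨d, by simp [toSp2, ofInt, scale]⟩
      · exact ⟨ε * (c * m - d * l), by simp [toSp2, ofInt, scale]⟩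
      · exact ⟨0, by simp [toSp2, ofInt, scale]⟩
      · exact ⟨ε, by simp [toSp2, ofInt, scale]⟩
    · rcases Int.units_eq_one_or ε with rfl | rfl <;> simp [toSp2, ofInt]

theorem mem_translationGroup_iff {N : ℕ} [NeZero N] {M : Sp2} : M ∈ translationGroup N ↔
    ∃ s t u : ℤ, M = (transl s t (u / N)).toSp2 := by
  constructor
  · rintro ⟨hM, h1, h2, h3⟩
    have hJ : M ∈ jacobiGroup N := by
      have e1 := fun i j => congrFun (congrFun h1 i) j
      have e2 := fun i j => congrFun (congrFun h2 i) j
      have e3 := fun i j => congrFun (congrFun h3 i) j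
      simp only [toBlocks₁₁, toBlocks₂₁, toBlocks₂₂, Matrix.of_apply] at e1 e2 e3
      refine ⟨hM, ?_⟩
      simp [e1, e2, e3]
    obtain ⟨a, b, c, d, l, m, κ, ε, h, rfl⟩ := mem_jacobiGroup_iff.1 hJ
    refine ⟨b, m, κ, ?_⟩
    simp only [toSp2, toBlocks_fromBlocks₁₁, toBlocks_fromBlocks₂₁, toBlocks_fromBlocks₂₂] at h1 h2 h3
    congr 1
    have a1 := congrFun (congrFun h1 0) 0
    have a2 := congrFun (congrFun h1 1) 0
    have a3 := congrFun (congrFun h1 1) 1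
    have a4 := congrFun (congrFun h2 0) 0
    have a5 := congrFun (congrFun h3 0) 0
    simp at a1 a2 a3 a4 a5
    ext <;> simp [transl, a1, a2, a3, a4, a5] <;> simp [ofInt]
  · rintro ⟨s, t, u, rfl⟩
    have hJ : (transl s t (u / N)).toSp2 ∈ jacobiGroup N :=
      mem_jacobiGroup_iff.2 ⟨1, s, 0, 1, 0, t, u, 1, by simp, by
        congr 1; ext <;> simp [transl, ofInt]⟩
    refine ⟨hJ.1, ?_, ?_, ?_⟩ <;> ext i j <;> fin_cases i <;> fin_cases j <;> simp [toSp2, transl]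

theorem translationGroup_le_jacobiGroup (N : ℕ) [NeZero N] :
    translationGroup N ≤ jacobiGroup N := by
  intro M hM
  obtain ⟨s, t, u, rfl⟩ := mem_translationGroup_iff.1 hM
  exact mem_jacobiGroup_iff.2 ⟨1, s, 0, 1, 0, t, u, 1, by simp, by
        congr 1; ext <;> simp [transl, ofInt]⟩

theorem heckeMatrix_eq (q : ℕ) (hq : q ≠ 0) :
    heckeMatrix q hq = (dil (1 / q) (by simpa using hq)).toSp2 := by
  have h : (q : ℝ) ≠ 0 := Nat.cast_ne_zero.2 hq
  apply Subtype.ext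
  ext i j
  rcases i with i | i <;> rcases j with j | j <;> fin_cases i <;> fin_cases j <;>
      simp [heckeMatrix, toSp2, dil, h] <;> field_simp

/-! ### The slash action of Jacobi elements -/

/-- The symmetric complex matrices whose upper left entry has positive imaginary part. -/
def upperLeftHalfSpace : Set (Matrix (Fin 2) (Fin 2) ℂ) :=
  {Z | Z.IsSymm ∧ 0 < (Z 0 0).im}

/-- For Jacobi elements det(CZ + D) = ε(cτ + d), so Im τ > 0 already makes the action well defined.
On this larger domain stability is just the SL₂ formula for Im τ, with no positive definiteness to
carry along. -/
theorem siegelHalfSpace_subset : siegelHalfSpace ⊆ upperLeftHalfSpace := fun Z hZ =>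
  ⟨hZ.1, by simpa using hZ.2.diag_pos (i := 0)⟩

/-- The cocycle relation for CZ + D. Only the inner factor has to be invertible, because the total
matrix inverse reverses arbitrary products. -/
theorem slash_mul {k : ℤ} {f : Matrix (Fin 2) (Fin 2) ℂ → ℂ} {M M' : Sp2}
    {Z : Matrix (Fin 2) (Fin 2) ℂ} (h : IsUnit (blockC M' * Z + blockD M').det) :
    slash k f (M * M') Z = slash k (slash k f M) M' Z := by
  have hm : (M * M').1 = M.1 * M'.1 := rfl
  have hb : M.1 * M'.1 = fromBlocks
      (M.1.toBlocks₁₁ * M'.1.toBlocks₁₁ + M.1.toBlocks₁₂ * M'.1.toBlocks₂₁)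
      (M.1.toBlocks₁₁ * M'.1.toBlocks₁₂ + M.1.toBlocks₁₂ * M'.1.toBlocks₂₂)
      (M.1.toBlocks₂₁ * M'.1.toBlocks₁₁ + M.1.toBlocks₂₂ * M'.1.toBlocks₂₁)
      (M.1.toBlocks₂₁ * M'.1.toBlocks₁₂ + M.1.toBlocks₂₂ * M'.1.toBlocks₂₂) := by
    rw [← fromBlocks_multiply, fromBlocks_toBlocks, fromBlocks_toBlocks]
  have map_mul' : ∀ X Y : Matrix (Fin 2) (Fin 2) ℝ, (X * Y).map (fun x : ℝ => (x : ℂ)) =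
      X.map (fun x : ℝ => (x : ℂ)) * Y.map (fun x : ℝ => (x : ℂ)) :=
    fun X Y => Matrix.map_mul (f := Complex.ofRealHom)
  have map_add' : ∀ X Y : Matrix (Fin 2) (Fin 2) ℝ, (X + Y).map (fun x : ℝ => (x : ℂ)) =
      X.map (fun x : ℝ => (x : ℂ)) + Y.map (fun x : ℝ => (x : ℂ)) :=
    fun X Y => Matrix.map_add _ (by simp) X Y
  have hA : blockA (M * M') = blockA M * blockA M' + blockB M * blockC M' := by
    simp only [blockA, blockB, blockC, hm, ← map_mul', ← map_add']
    rw [hb, toBlocks_fromBlocks₁₁]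
  have hB : blockB (M * M') = blockA M * blockB M' + blockB M * blockD M' := by
    simp only [blockA, blockB, blockD, hm, ← map_mul', ← map_add']
    rw [hb, toBlocks_fromBlocks₁₂]
  have hC : blockC (M * M') = blockC M * blockA M' + blockD M * blockC M' := by
    simp only [blockA, blockD, blockC, hm, ← map_mul', ← map_add']
    rw [hb, toBlocks_fromBlocks₂₁]
  have hD : blockD (M * M') = blockC M * blockB M' + blockD M * blockD M' := by
    simp only [blockC, blockB, blockD, hm, ← map_mul', ← map_add']
    rw [hb, toBlocks_fromBlocks₂₂]
  have key : ∀ X Y : Matrix (Fin 2) (Fin 2) ℂ,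
      (X * blockA M' + Y * blockC M') * Z + (X * blockB M' + Y * blockD M') =
      (X * moebius M' Z + Y) * (blockC M' * Z + blockD M') := by
    intro X Y
    have hinv : moebius M' Z * (blockC M' * Z + blockD M') = blockA M' * Z + blockB M' := by
      rw [moebius, mul_assoc, Matrix.nonsing_inv_mul _ h, mul_one]
    rw [add_mul (X * moebius M' Z), mul_assoc X (moebius M' Z), hinv]
    noncomm_ring
  have hCD : blockC (M * M') * Z + blockD (M * M') =
      (blockC M * moebius M' Z + blockD M) * (blockC M' * Z + blockD M') := by
    rw [hC, hD, key]
  have hAB : blockA (M * M') * Z + blockB (M * M') =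
      (blockA M * moebius M' Z + blockB M) * (blockC M' * Z + blockD M') := by
    rw [hA, hB, key]
  have hmo : moebius (M * M') Z = moebius M (moebius M' Z) := by
    rw [moebius, hAB, hCD, Matrix.mul_inv_rev, ← mul_assoc, mul_assoc (_ + _),
      Matrix.mul_nonsing_inv _ h, mul_one]
    rfl
  rw [slash, slash, slash, hmo, hCD, det_mul, mul_zpow]
  ring

namespace JacobiElt

/-- The factor `c τ + d`. -/
def denom (P : JacobiElt) (τ : ℂ) : ℂ := P.c * τ + P.d

theorem denom_ne_zero (P : JacobiElt) {τ : ℂ} (hτ : 0 < τ.im) : P.denom τ ≠ 0 := by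
  intro h
  have h1 := congrArg Complex.im h
  have h2 := congrArg Complex.re h
  have h3 := P.det
  simp [denom, hτ.ne'] at h1 h2
  simp [h1] at h2
  simp [h1, h2] at h3

theorem ε_ne_zero (P : JacobiElt) : (P.ε : ℂ) ≠ 0 := by
  intro h
  have h1 := P.sq
  rw [Complex.ofReal_eq_zero] at h
  simp [h] at h1

theorem denom_matrix (P : JacobiElt) {Z : Matrix (Fin 2) (Fin 2) ℂ} :
    blockC P.toSp2 * Z + blockD P.toSp2 =
      !![P.denom (Z 0 0), P.c * Z 0 1 + P.ε * (P.c * P.m - P.d * P.l); 0, P.ε] := by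
  ext i j
  fin_cases i <;> fin_cases j <;>
    simp [blockC, blockD, toSp2, Matrix.mul_apply, Fin.sum_univ_two, denom]

theorem det_denom (P : JacobiElt) {Z : Matrix (Fin 2) (Fin 2) ℂ} :
    (blockC P.toSp2 * Z + blockD P.toSp2).det = P.ε * P.denom (Z 0 0) := by
  rw [denom_matrix, det_fin_two_of]
  ring

theorem isUnit_det_denom (P : JacobiElt) {Z : Matrix (Fin 2) (Fin 2) ℂ}
    (hZ : Z ∈ upperLeftHalfSpace) : IsUnit (blockC P.toSp2 * Z + blockD P.toSp2).det := by
  rw [det_denom]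
  exact (mul_ne_zero P.ε_ne_zero (P.denom_ne_zero hZ.2)).isUnit

theorem moebius_eq (P : JacobiElt) {Z : Matrix (Fin 2) (Fin 2) ℂ}
    (hZ : Z ∈ upperLeftHalfSpace) : moebius P.toSp2 Z =
      !![(P.a * Z 0 0 + P.b) / P.denom (Z 0 0),
        (P.l * Z 0 0 + P.ε * Z 0 1 + P.m) / P.denom (Z 0 0);
        (P.l * Z 0 0 + P.ε * Z 0 1 + P.m) / P.denom (Z 0 0),
        Z 1 1 + P.ε * P.l * Z 0 1 + P.ε * P.κ - P.ε * (P.l * Z 0 0 + P.ε * Z 0 1 + P.m) *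
          (P.c * Z 0 1 + P.ε * (P.c * P.m - P.d * P.l)) / P.denom (Z 0 0)] := by
  have hp := P.denom_ne_zero hZ.2
  have he := P.ε_ne_zero
  have hs : (P.ε : ℂ) * P.ε = 1 := by exact_mod_cast P.sq
  have hd : (P.a : ℂ) * P.d - P.b * P.c = 1 := by exact_mod_cast P.det
  have hsym : Z 1 0 = Z 0 1 := hZ.1.apply 0 1
  have hinv : (blockC P.toSp2 * Z + blockD P.toSp2)⁻¹ =
      !![1 / P.denom (Z 0 0), -(P.ε * (P.c * Z 0 1 + P.ε * (P.c * P.m - P.d * P.l))) /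
        P.denom (Z 0 0); 0, P.ε] := by
    apply Matrix.inv_eq_right_inv
    rw [denom_matrix]
    ext i j
    fin_cases i <;> fin_cases j <;>
      simp [hp, hs, Matrix.mul_apply, Fin.sum_univ_two]
    field_simp
    ring
  rw [moebius, hinv]
  have hd' : P.denom (Z 0 0) = P.c * Z 0 0 + P.d := rfl
  ext i j
  fin_cases i <;> fin_cases j <;>
    simp [blockA, blockB, toSp2, Matrix.mul_apply, Fin.sum_univ_two, hsym]
  · ring
  · field_simp
    rw [hd']
    grind
  · ring
  · field_simp
    grind

theorem moebius_mem (P : JacobiElt) {Z : Matrix (Fin 2) (Fin 2) ℂ}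
    (hZ : Z ∈ upperLeftHalfSpace) : moebius P.toSp2 Z ∈ upperLeftHalfSpace := by
  rw [moebius_eq P hZ]
  refine ⟨?_, ?_⟩
  · ext i j
    fin_cases i <;> fin_cases j <;> simp
  · have hp := P.denom_ne_zero hZ.2
    have h1 : ((P.a * Z 0 0 + P.b) / P.denom (Z 0 0)).im =
        (Z 0 0).im / Complex.normSq (P.denom (Z 0 0)) := by
      have := P.det
      rw [Complex.div_im, ← sub_div]
      congr 1
      simp [denom]
      linear_combination (Z 0 0).im * this
    change 0 < ((P.a * Z 0 0 + P.b) / P.denom (Z 0 0)).im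
    rw [h1]
    exact div_pos hZ.2 (Complex.normSq_pos.2 hp)

theorem slash_phi (P : JacobiElt) (k : ℤ) (N : ℕ) {Z : Matrix (Fin 2) (Fin 2) ℂ}
    (hZ : Z ∈ upperLeftHalfSpace) : slash k (phi N) P.toSp2 Z =
      (P.ε * P.denom (Z 0 0)) ^ (-k) * Complex.exp (2 * Real.pi * Complex.I * N *
        (Z 1 1 + P.ε * P.l * Z 0 1 + P.ε * P.κ - P.ε * (P.l * Z 0 0 + P.ε * Z 0 1 + P.m) *
          (P.c * Z 0 1 + P.ε * (P.c * P.m - P.d * P.l)) / P.denom (Z 0 0))) := by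
  rw [slash, det_denom, phi, moebius_eq P hZ]
  rfl

theorem slash_toSp2_mul (P Q : JacobiElt) (k : ℤ) (f : Matrix (Fin 2) (Fin 2) ℂ → ℂ)
    {Z : Matrix (Fin 2) (Fin 2) ℂ} (hZ : Z ∈ upperLeftHalfSpace) :
    slash k f (P.toSp2 * Q.toSp2) Z = slash k (slash k f P.toSp2) Q.toSp2 Z :=
  slash_mul (Q.isUnit_det_denom hZ)

theorem slash_congr (P : JacobiElt) (k : ℤ) {f g : Matrix (Fin 2) (Fin 2) ℂ → ℂ}
    (hfg : ∀ Z ∈ upperLeftHalfSpace, f Z = g Z)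
    {Z : Matrix (Fin 2) (Fin 2) ℂ} (hZ : Z ∈ upperLeftHalfSpace) :
    slash k f P.toSp2 Z = slash k g P.toSp2 Z := by
  rw [slash, slash, hfg _ (P.moebius_mem hZ)]

end JacobiElt

theorem slash_const_mul (k : ℤ) (t : ℂ) (f : Matrix (Fin 2) (Fin 2) ℂ → ℂ) (M : Sp2)
    (Z : Matrix (Fin 2) (Fin 2) ℂ) : slash k (fun W => t * f W) M Z = t * slash k f M Z := by
  simp only [slash]
  ring

/-! ### Transversals -/

/-- The family `u` represents every coset `Γ L` with `L ∈ S` exactly once. -/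
structure IsTransversal (Γ : Subgroup Sp2) (S : Set Sp2) {ι : Type*} (u : ι → Sp2) : Prop where
  mem : ∀ i, u i ∈ S
  surj : ∀ L ∈ S, ∃ i, ∃ γ ∈ Γ, L = γ * u i
  inj : ∀ i j, ∀ γ ∈ Γ, u i = γ * u j → i = j

theorem isTransversal_rep (Γ : Subgroup Sp2) (S : Set Sp2) :
    IsTransversal Γ S (CosetSpace.rep : CosetSpace Γ S → Sp2) where
  mem c := (Quotient.out c).2
  surj L hL := by
    refine ⟨Quotient.mk _ ⟨L, hL⟩, L * (CosetSpace.rep (Quotient.mk _ ⟨L, hL⟩))⁻¹, ?_,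
      (inv_mul_cancel_right _ _).symm⟩
    have h := Quotient.mk_out (s := (QuotientGroup.rightRel Γ).comap (Subtype.val : S → Sp2))
      ⟨L, hL⟩
    exact QuotientGroup.rightRel_apply.1 h
  inj c c' γ hγ h := by
    rw [← Quotient.out_eq c, ← Quotient.out_eq c']
    refine Quotient.sound (QuotientGroup.rightRel_apply.2 ?_)
    have h' : (Quotient.out c).1 = γ * (Quotient.out c').1 := h
    rw [h', _root_.mul_inv_rev, mul_inv_cancel_left]
    exact inv_mem hγ

theorem IsTransversal.exists_equiv {Γ : Subgroup Sp2} {S : Set Sp2} {ι κ : Type*} {u : ι → Sp2}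
    {w : κ → Sp2} (hu : IsTransversal Γ S u) (hw : IsTransversal Γ S w) :
    ∃ e : ι ≃ κ, ∀ i, ∃ γ ∈ Γ, u i = γ * w (e i) := by
  choose f hf using fun i => hw.surj (u i) (hu.mem i)
  refine ⟨Equiv.ofBijective f ⟨fun i j hij => ?_, fun y => ?_⟩, hf⟩
  · obtain ⟨γ, hγ, h1⟩ := hf i
    obtain ⟨δ, hδ, h2⟩ := hf j
    refine hu.inj i j (γ * δ⁻¹) (mul_mem hγ (inv_mem hδ)) ?_
    rw [h1, h2, hij]
    group
  · obtain ⟨i, γ, hγ, h⟩ := hu.surj (w y) (hw.mem y)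
    obtain ⟨δ, hδ, h2⟩ := hf i
    refine ⟨i, (hw.inj y (f i) (γ * δ) (mul_mem hγ hδ) ?_).symm⟩
    rw [h, h2, mul_assoc]

/-- Two transversals give the same sum of a left `Γ`-invariant function. -/
theorem IsTransversal.summable_iff_and_tsum_eq {Γ : Subgroup Sp2} {S : Set Sp2} {ι κ : Type*}
    {u : ι → Sp2} {w : κ → Sp2} (hu : IsTransversal Γ S u) (hw : IsTransversal Γ S w)
    {F : Sp2 → ℂ} (hF : ∀ γ ∈ Γ, ∀ L ∈ S, F (γ * L) = F L) :
    (Summable (fun i => F (u i)) ↔ Summable fun j => F (w j)) ∧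
      ∑' i, F (u i) = ∑' j, F (w j) := by
  obtain ⟨e, he⟩ := hu.exists_equiv hw
  have h : (fun i => F (u i)) = (fun j => F (w j)) ∘ e := by
    funext i
    obtain ⟨γ, hγ, h⟩ := he i
    rw [h, hF γ hγ _ (hw.mem _)]
    rfl
  rw [h]
  exact ⟨e.summable_iff, e.tsum_eq (fun j => F (w j))⟩

/-- A transversal of `Γ \ J` and one of `J \ S` combine to one of `Γ \ S`. -/
theorem IsTransversal.mul {Γ J : Subgroup Sp2} (hΓ : Γ ≤ J) {S : Set Sp2}
    (hS : ∀ j ∈ J, ∀ L ∈ S, j * L ∈ S) {ι κ : Type*} {u : ι → Sp2} {w : κ → Sp2}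
    (hu : IsTransversal Γ J u) (hw : IsTransversal J S w) :
    IsTransversal Γ S (fun x : κ × ι => u x.2 * w x.1) where
  mem x := hS _ (hu.mem _) _ (hw.mem _)
  surj L hL := by
    obtain ⟨c, j, hj, rfl⟩ := hw.surj L hL
    obtain ⟨y, γ, hγ, rfl⟩ := hu.surj j hj
    exact ⟨(c, y), γ, hγ, mul_assoc _ _ _⟩
  inj := by
    rintro ⟨c, y⟩ ⟨c', y'⟩ γ hγ h
    have hc : c = c' := by
      refine hw.inj c c' ((u y)⁻¹ * γ * u y')
        (mul_mem (mul_mem (inv_mem (hu.mem y)) (hΓ hγ)) (hu.mem y')) ?_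
      dsimp only at h
      rw [mul_assoc, mul_assoc, ← h]
      group
    subst hc
    have hy : y = y' := by
      refine hu.inj y y' γ hγ ?_
      dsimp only at h
      rwa [← mul_assoc, mul_left_inj] at h
    rw [hy]

theorem IsTransversal.mul_right {Γ J : Subgroup Sp2} {ι : Type*} {u : ι → Sp2}
    (hu : IsTransversal Γ J u) {M : Sp2} (hM : M ∈ J) :
    IsTransversal Γ J (fun i => u i * M) where
  mem i := mul_mem (hu.mem i) hM
  surj L hL := by
    obtain ⟨i, γ, hγ, h⟩ := hu.surj (L * M⁻¹) (mul_mem hL (inv_mem hM))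
    exact ⟨i, γ, hγ, by rw [← mul_assoc, ← h]; group⟩
  inj i j γ hγ h := hu.inj i j γ hγ (by rwa [← mul_assoc, mul_left_inj] at h)

/-- Left multiplication permutes the cosets Γ\J because M normalizes Γ. -/
theorem IsTransversal.mul_left {Γ J : Subgroup Sp2} {ι : Type*} {u : ι → Sp2}
    (hu : IsTransversal Γ J u) {M : Sp2} (hM : M ∈ J) (hΓ : ∀ γ ∈ Γ, M * γ * M⁻¹ ∈ Γ)
    (hΓ' : ∀ γ ∈ Γ, M⁻¹ * γ * M ∈ Γ) :
    IsTransversal Γ J (fun i => M * u i) where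
  mem i := mul_mem hM (hu.mem i)
  surj L hL := by
    obtain ⟨i, γ, hγ, h⟩ := hu.surj (M⁻¹ * L) (mul_mem (inv_mem hM) hL)
    refine ⟨i, _, hΓ γ hγ, ?_⟩
    rw [show L = M * (M⁻¹ * L) by group, h]
    group
  inj i j γ hγ h := by
    refine hu.inj i j _ (hΓ' γ hγ) ?_
    rw [mul_assoc, mul_assoc, ← h]
    group

/-! ### Invariance -/

/-- A translation moves τ' by u/N with u an integer, which φ_N does not see. -/
theorem slash_phi_translation_mul (k : ℤ) (N : ℕ) [NeZero N] {γ : Sp2}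
    (hγ : γ ∈ translationGroup N) (P : JacobiElt) {Z : Matrix (Fin 2) (Fin 2) ℂ}
    (hZ : Z ∈ upperLeftHalfSpace) :
    slash k (phi N) (γ * P.toSp2) Z = slash k (phi N) P.toSp2 Z := by
  obtain ⟨s, t, u, rfl⟩ := mem_translationGroup_iff.1 hγ
  rw [slash_toSp2_mul _ _ _ _ hZ]
  refine slash_congr _ _ (fun W hW => ?_) hZ
  have hN : (N : ℂ) ≠ 0 := Nat.cast_ne_zero.2 (NeZero.ne N)
  rw [slash_phi _ _ _ hW, phi]
  have h : 2 * Real.pi * Complex.I * N * (W 1 1 + (u / N : ℂ)) =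
      2 * Real.pi * Complex.I * N * W 1 1 + u * (2 * Real.pi * Complex.I) := by
    field_simp
  simp only [transl, denom]
  push_cast
  simp [h, Complex.exp_add, Complex.exp_int_mul_two_pi_mul_I]

theorem exists_toSp2_of_mem_jacobiGroup {N : ℕ} [NeZero N] {M : Sp2} (hM : M ∈ jacobiGroup N) :
    ∃ P : JacobiElt, M = P.toSp2 := by
  obtain ⟨a, b, c, d, l, m, κ, ε, h, rfl⟩ := mem_jacobiGroup_iff.1 hM
  exact ⟨_, rfl⟩

/-! ### Explicit coset representatives -/

/-- Pairs of coprime integers. -/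
abbrev CoprimePair : Type := {v : Fin 2 → ℤ // IsCoprime (v 0) (v 1)}

namespace CoprimePair

/-- The upper left entry of a matrix of determinant one with bottom row `v`. -/
def topLeft (v : CoprimePair) : ℤ := v.2.choose_spec.choose

/-- The upper right entry of a matrix of determinant one with bottom row `v`. -/
def topRight (v : CoprimePair) : ℤ := -v.2.choose

theorem det_eq_one (v : CoprimePair) : v.topLeft * v.1 1 - v.topRight * v.1 0 = 1 := by
  have h := v.2.choose_spec.choose_spec
  rw [topLeft, topRight]
  linear_combination h

theorem ne_zero (v : CoprimePair) : v.1 ≠ 0 := by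
  intro h
  have := v.det_eq_one
  simp [h] at this

theorem one_le_norm (v : CoprimePair) : 1 ≤ ‖v.1‖ := by
  obtain ⟨i, hi⟩ := Function.ne_iff.1 v.ne_zero
  refine le_trans ?_ (norm_le_pi_norm v.1 i)
  rw [Int.norm_eq_abs]
  exact_mod_cast Int.one_le_abs hi

end CoprimePair

/-- A representative of the coset of the translation group given by a sign, a bottom row and a
Heisenberg coordinate. -/
def cosetElt (N : ℕ) (x : ℤˣ × CoprimePair × ℤ) : JacobiElt :=
  ofInt N x.2.1.topLeft x.2.1.topRight (x.2.1.1 0) (x.2.1.1 1) (x.2.2 * x.2.1.topLeft)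
    (x.2.2 * x.2.1.topRight) 0 x.1 x.2.1.det_eq_one

/-- A translation (s, t, u) on the left fixes ε and (c, d), adds s(c, d) to (a, b) and t(c, d) to
(l, m), and moves κ by integral multiples of 1/N. The invariants are therefore ε, (c, d) and r = ld
- mc, and (l, m) can be brought to r(a, b). -/
theorem isTransversal_cosetElt (N : ℕ) [NeZero N] :
    IsTransversal (translationGroup N) (jacobiGroup N : Set Sp2)
      (fun x => (cosetElt N x).toSp2) where
  mem x := mem_jacobiGroup_iff.2 ⟨_, _, _, _, _, _, _, _, _, rfl⟩
  surj L hL := by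
    obtain ⟨a', b', c, d, l, m, κ, ε, h, rfl⟩ := mem_jacobiGroup_iff.1 hL
    let v : CoprimePair := ⟨![c, d], ⟨-b', a', by simp; linear_combination h⟩⟩
    have hv := v.det_eq_one
    obtain ⟨a, ha⟩ : ∃ a, v.topLeft = a := ⟨_, rfl⟩
    obtain ⟨b, hb⟩ : ∃ b, v.topRight = b := ⟨_, rfl⟩
    have hc : v.1 0 = c := rfl
    have hd : v.1 1 = d := rfl
    rw [ha, hb, hc, hd] at hv
    set r := l * d - m * c with hr
    have hN : (N : ℝ) ≠ 0 := Nat.cast_ne_zero.2 (NeZero.ne N)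
    have hs : ((ε : ℤ) : ℝ) * (ε : ℤ) = 1 := by exact_mod_cast Int.units_coe_mul_self ε
    have h' : (a' * d - b' * c : ℝ) = 1 := by exact_mod_cast h
    have hv' : (a * d - b * c : ℝ) = 1 := by exact_mod_cast hv
    -- The first entry is the upper right entry of (a' b'; c d)(a b; c d)⁻¹; the second is the
    -- coefficient t in (l, m) = r(a, b) + t(c, d).
    refine ⟨(ε, v, r), _, mem_translationGroup_iff.2
      ⟨b' * a - a' * b, m * a - l * b, ε * κ + N * (m * a - l * b) * r, rfl⟩, ?_⟩
    rw [← toSp2_mul]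
    congr 1
    ext
    · simp [mul_def, cosetElt, transl, ofInt, ha, hb, hc, hd]
      linear_combination a * h' - a' * hv'
    · simp [mul_def, cosetElt, transl, ofInt, ha, hb, hc, hd]
      linear_combination b * h' - b' * hv'
    · simp [mul_def, cosetElt, transl, ofInt, ha, hb, hc, hd]
    · simp [mul_def, cosetElt, transl, ofInt, ha, hb, hc, hd]
    · simp [mul_def, cosetElt, transl, ofInt, ha, hb, hc, hd, hr]
      linear_combination -l * hv'
    · simp [mul_def, cosetElt, transl, ofInt, ha, hb, hc, hd, hr]
      linear_combination -m * hv'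
    · simp [mul_def, cosetElt, transl, ofInt, ha, hb, hc, hd]
      field_simp
      linear_combination -(κ : ℝ) * hs + (N * (m * a - l * b) * r * ε : ℝ) * hv'
    · simp [mul_def, cosetElt, transl, ofInt]
  inj := by
    rintro ⟨ε, v, r⟩ ⟨ε', v', r'⟩ γ hγ h
    obtain ⟨s, t, u, rfl⟩ := mem_translationGroup_iff.1 hγ
    rw [← toSp2_mul] at h
    have h := toSp2_injective h
    have hε : ε = ε' := by
      have := congrArg JacobiElt.ε h
      simp [mul_def, cosetElt, transl, ofInt] at this
      exact Units.ext this
    have hv : v = v' := by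
      have h0 := congrArg JacobiElt.c h
      have h1 := congrArg JacobiElt.d h
      simp [mul_def, cosetElt, transl, ofInt] at h0 h1
      apply Subtype.ext
      ext i
      fin_cases i
      exacts [h0, h1]
    subst hε hv
    have hd : (v.topLeft * v.1 1 - v.topRight * v.1 0 : ℝ) = 1 := by exact_mod_cast v.det_eq_one
    have h0 := congrArg JacobiElt.l h
    have h1 := congrArg JacobiElt.m h
    simp [mul_def, cosetElt, transl, ofInt] at h0 h1
    have : (r : ℝ) = r' := by
      linear_combination (v.1 1 : ℝ) * h0 - (v.1 0 : ℝ) * h1 - (r - r' : ℝ) * hd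
    have : r = r' := by exact_mod_cast this
    rw [this]

/-! ### Absolute convergence -/

/-- Completing the square in r after z = ατ + β. For real parameters the final bracket is real, so
the size of the term comes only from the square times Im((aτ+b)/(cτ+d)) = Im τ/|cτ+d|² and from
-α²τ. -/
theorem exponent_eq {a b c d ε r α β τ : ℂ} (h : a * d - b * c = 1) (hε : ε * ε = 1)
    (hp : c * τ + d ≠ 0) :
    ε * (r * a) * (α * τ + β) - ε * (r * a * τ + ε * (α * τ + β) + r * b) *
        (c * (α * τ + β) + ε * (c * (r * b) - d * (r * a))) / (c * τ + d) =
      (r * ε + (α * d - β * c)) ^ 2 * ((a * τ + b) / (c * τ + d)) - α ^ 2 * τ +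
        (2 * ε * r * (β * a - α * b) -
          (α ^ 2 * d * b + 2 * α * β * (1 - d * a) + β ^ 2 * c * a)) := by
  have h1 : c * (r * b) - d * (r * a) = -r := by linear_combination -r * h
  rw [h1, div_eq_mul_inv, div_eq_mul_inv]
  have k1 : (c * τ + d) * (c * τ + d)⁻¹ = 1 := mul_inv_cancel₀ hp
  set i := (c * τ + d)⁻¹
  -- Both 1/(cτ+d) and τ/(cτ+d) are affine in (aτ+b)/(cτ+d), which reduces the claim to a polynomial
  -- identity.
  have k2 : i = a - c * ((a * τ + b) * i) := by linear_combination a * k1 - i * h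
  have k3 : τ * i = d * ((a * τ + b) * i) - b := by linear_combination -τ * i * h - b * k1
  linear_combination -ε * r * (α * τ + β) * k2 + ε * r * (α * τ + β) * i * hε +
    2 * ε * r * (α * k3 + β * k2) - c * (α * τ + β) ^ 2 * i * hε -
    (α ^ 2 * τ * k1 - α ^ 2 * d * k3 + 2 * α * β * k1 - 2 * α * β * d * k2 + β ^ 2 * c * k2)

/-- The real numbers `α` and `β` with `z = α τ + β`. -/
def slope (Z : Matrix (Fin 2) (Fin 2) ℂ) : ℝ := (Z 0 1).im / (Z 0 0).im

/-- The shift of the Heisenberg coordinate in the growth of a term of the Eisenstein series. -/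
def shift (Z : Matrix (Fin 2) (Fin 2) ℂ) (v : CoprimePair) : ℝ :=
  slope Z * v.1 1 - ((Z 0 1).re - slope Z * (Z 0 0).re) * v.1 0

theorem norm_slash_cosetElt (k : ℤ) (N : ℕ) {Z : Matrix (Fin 2) (Fin 2) ℂ}
    (hZ : Z ∈ upperLeftHalfSpace) (x : ℤˣ × CoprimePair × ℤ) :
    ‖slash k (phi N) (cosetElt N x).toSp2 Z‖ =
      Real.exp (-(2 * Real.pi * N * ((Z 1 1).im - slope Z ^ 2 * (Z 0 0).im))) *
      (‖(x.2.1.1 0 : ℂ) * Z 0 0 + x.2.1.1 1‖ ^ (-k) *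
        Real.exp (-(2 * Real.pi * N * (Z 0 0).im * (x.2.2 * x.1 + shift Z x.2.1) ^ 2 /
          ‖(x.2.1.1 0 : ℂ) * Z 0 0 + x.2.1.1 1‖ ^ 2))) := by
  obtain ⟨ε, v, r⟩ := x
  rw [slash_phi _ _ _ hZ]
  have hy : 0 < (Z 0 0).im := hZ.2
  have hp := (cosetElt N (ε, v, r)).denom_ne_zero hy
  have hz : Z 0 1 = (slope Z : ℂ) * Z 0 0 + ((Z 0 1).re - slope Z * (Z 0 0).re : ℝ) := by
    apply Complex.ext <;> simp [slope]
    field_simp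
  set α := slope Z
  set β := (Z 0 1).re - slope Z * (Z 0 0).re with hβ
  have hs : ((ε : ℤ) : ℂ) * (ε : ℤ) = 1 := by exact_mod_cast Int.units_coe_mul_self ε
  have hd : (v.topLeft * v.1 1 - v.topRight * v.1 0 : ℂ) = 1 := by exact_mod_cast v.det_eq_one
  have hdR : (v.topLeft * v.1 1 - v.topRight * v.1 0 : ℝ) = 1 := by exact_mod_cast v.det_eq_one
  simp only [cosetElt, ofInt, denom, Int.cast_mul, Complex.ofReal_intCast, Complex.ofReal_mul,
    Int.cast_zero, zero_div, Complex.ofReal_zero, mul_zero, add_zero] at hp ⊢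
  rw [norm_mul, Complex.norm_exp, norm_zpow, norm_mul]
  have hε : ‖((ε : ℤ) : ℂ)‖ = 1 := by
    rcases Int.units_eq_one_or ε with rfl | rfl <;> simp
  rw [hε, one_mul, mul_left_comm (Real.exp _), ← Real.exp_add]
  congr 2
  have hE := exponent_eq (r := (r : ℂ)) (α := (α : ℂ)) (β := (β : ℂ)) hd hs hp
  rw [← hz] at hE
  rw [add_sub_assoc, hE]
  have hG : (((v.topLeft : ℂ) * Z 0 0 + v.topRight) / (v.1 0 * Z 0 0 + v.1 1)).im =
      (Z 0 0).im / ‖(v.1 0 : ℂ) * Z 0 0 + v.1 1‖ ^ 2 := by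
    rw [Complex.div_im, ← sub_div, ← Complex.normSq_eq_norm_sq]
    congr 1
    simp
    linear_combination (Z 0 0).im * hdR
  set G := ((v.topLeft : ℂ) * Z 0 0 + v.topRight) / (v.1 0 * Z 0 0 + v.1 1) with hGdef
  have hsh : shift Z v = α * v.1 1 - β * v.1 0 := rfl
  have e1 : ((r : ℂ) * (ε : ℤ) + (α * v.1 1 - β * v.1 0)) ^ 2 =
      (((r * (ε : ℤ) + (α * v.1 1 - β * v.1 0)) ^ 2 : ℝ) : ℂ) := by push_cast; rfl
  have e2 : (2 * (ε : ℤ) * r * (β * v.topLeft - α * v.topRight) -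
          (α ^ 2 * v.1 1 * v.topRight + 2 * α * β * (1 - v.1 1 * v.topLeft) +
            β ^ 2 * v.1 0 * v.topLeft) : ℂ) =
      ((2 * (ε : ℤ) * r * (β * v.topLeft - α * v.topRight) -
          (α ^ 2 * v.1 1 * v.topRight + 2 * α * β * (1 - v.1 1 * v.topLeft) +
            β ^ 2 * v.1 0 * v.topLeft) : ℝ) : ℂ) := by push_cast; rfl
  have e3 : (2 * Real.pi * Complex.I * N : ℂ) = ((2 * Real.pi * N : ℝ) : ℂ) * Complex.I := by
    push_cast; ring
  rw [e1, e2, e3, mul_assoc, Complex.re_ofReal_mul, ← Complex.ofReal_pow α, Complex.I_mul_re,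
    Complex.add_im, Complex.add_im, Complex.sub_im, Complex.im_ofReal_mul, Complex.im_ofReal_mul,
    Complex.ofReal_im, hG, hsh]
  ring

/-- With t proportional to m²/P² the exponent 3/4 gives |m|^(-3/2), summable over the integers, at
the cost of P^(3/2). -/
theorem exp_neg_le_rpow {t : ℝ} (ht : 0 < t) : Real.exp (-t) ≤ t ^ (-(3 / 4) : ℝ) := by
  rw [Real.exp_neg, Real.rpow_neg ht.le]
  apply inv_anti₀ (by positivity)
  rcases le_total t 1 with h | h
  · exact (Real.rpow_le_one ht.le h (by norm_num)).trans (Real.one_le_exp ht.le)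
  · calc t ^ (3 / 4 : ℝ) ≤ t ^ (1 : ℝ) := Real.rpow_le_rpow_of_exponent_le h (by norm_num)
      _ = t := Real.rpow_one t
      _ ≤ Real.exp t := by linarith [Real.add_one_le_exp t]

/-- A summable weight on the integers. -/
def weight (m : ℤ) : ℝ := |(m : ℝ)| ^ (-(3 / 2) : ℝ) + if m = 0 then 1 else 0

theorem weight_nonneg (m : ℤ) : 0 ≤ weight m := by
  unfold weight
  positivity

theorem summable_weight : Summable weight := by
  refine Summable.add (Real.summable_abs_int_rpow (by norm_num)) ?_
  exact summable_of_ne_finset_zero (s := {0}) (by simp)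

/-- After paying P^(3/2) for decay in m, the power P^(-(k - 3/2)) remains. For k ≥ 4 the exponent k
- 3/2 is at least 5/2, above the threshold 2 for summing over pairs (c, d). The constants depend on
Y only through its lower bound Y₀, so the bound can be uniform in a parameter. -/
theorem zpow_mul_exp_le {r Y₀ Y n P : ℝ} {k : ℤ} (hk : 4 ≤ k) (hr : 0 < r) (hr1 : r ≤ 1)
    (hY₀ : 0 < Y₀) (hY₁ : Y₀ ≤ 1) (hY : Y₀ ≤ Y) (hn : 1 ≤ n) (hP : r * n ≤ P) (m : ℤ) :
    P ^ (-k) * Real.exp (-(Y * m ^ 2 / P ^ 2)) ≤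
      r ^ (-k : ℝ) * Y₀ ^ (-(3 / 4) : ℝ) * (n ^ (-(5 / 2) : ℝ) * weight m) := by
  have hn0 : 0 < n := by linarith
  have hrn : 0 < r * n := by positivity
  have hP0 : 0 < P := hrn.trans_le hP
  have hk' : (4 : ℝ) ≤ k := by exact_mod_cast hk
  have hYc : 1 ≤ Y₀ ^ (-(3 / 4) : ℝ) := Real.one_le_rpow_of_pos_of_le_one_of_nonpos hY₀ hY₁
    (by norm_num)
  have hPk : P ^ (-k) = P ^ (-k : ℝ) := by
    rw [← Real.rpow_intCast]
    push_cast
    rfl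
  rw [hPk]
  have base : ∀ s : ℝ, 5 / 2 ≤ s → s ≤ k → P ^ (-s) ≤ r ^ (-k : ℝ) * n ^ (-(5 / 2) : ℝ) := by
    intro s hs hsk
    calc P ^ (-s) ≤ (r * n) ^ (-s) := Real.rpow_le_rpow_of_nonpos hrn hP (by linarith)
      _ = r ^ (-s) * n ^ (-s) := Real.mul_rpow hr.le hn0.le
      _ ≤ r ^ (-k : ℝ) * n ^ (-(5 / 2) : ℝ) :=
        mul_le_mul (Real.rpow_le_rpow_of_exponent_ge hr hr1 (by linarith))
          (Real.rpow_le_rpow_of_exponent_le hn (by linarith)) (by positivity) (by positivity)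
  by_cases hm : m = 0
  · subst hm
    -- The power of 0 with exponent -3/2 has the default value 0, so only the indicator contributes.
    have hw : weight 0 = 1 := by
      simp [weight, Real.zero_rpow (show (-(3 / 2) : ℝ) ≠ 0 by norm_num)]
    rw [hw]
    simp only [Int.cast_zero, ne_eq, OfNat.ofNat_ne_zero, not_false_eq_true, zero_pow, mul_zero,
      zero_div, neg_zero, Real.exp_zero, mul_one]
    calc P ^ (-k : ℝ) ≤ r ^ (-k : ℝ) * n ^ (-(5 / 2) : ℝ) := base k (by linarith) le_rfl
      _ = r ^ (-k : ℝ) * 1 * n ^ (-(5 / 2) : ℝ) := by ring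
      _ ≤ _ := by gcongr
  · have hm0 : 0 < |(m : ℝ)| := by positivity
    have hw : weight m = |(m : ℝ)| ^ (-(3 / 2) : ℝ) := by simp [weight, hm]
    have hY0 : 0 < Y := hY₀.trans_le hY
    have ht : 0 < Y * m ^ 2 / P ^ 2 := by positivity
    have h1 : (Y * m ^ 2 / P ^ 2) ^ (-(3 / 4) : ℝ) =
        Y ^ (-(3 / 4) : ℝ) * |(m : ℝ)| ^ (-(3 / 2) : ℝ) * P ^ (3 / 2 : ℝ) := by
      rw [← sq_abs (m : ℝ), Real.div_rpow (by positivity) (by positivity),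
        Real.mul_rpow hY0.le (by positivity), ← Real.rpow_natCast, ← Real.rpow_natCast,
        ← Real.rpow_mul hm0.le, ← Real.rpow_mul hP0.le, div_eq_mul_inv, ← Real.rpow_neg hP0.le]
      norm_num
    rw [hw]
    calc P ^ (-k : ℝ) * Real.exp (-(Y * m ^ 2 / P ^ 2))
        ≤ P ^ (-k : ℝ) * (Y ^ (-(3 / 4) : ℝ) * |(m : ℝ)| ^ (-(3 / 2) : ℝ) * P ^ (3 / 2 : ℝ)) := by
          rw [← h1]
          gcongr
          exact exp_neg_le_rpow ht
      _ = P ^ (-(k - 3 / 2) : ℝ) * (Y ^ (-(3 / 4) : ℝ) * |(m : ℝ)| ^ (-(3 / 2) : ℝ)) := by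
          rw [show (-(k - 3 / 2) : ℝ) = -k + 3 / 2 by ring, Real.rpow_add hP0]
          ring
      _ ≤ (r ^ (-k : ℝ) * n ^ (-(5 / 2) : ℝ)) *
            (Y₀ ^ (-(3 / 4) : ℝ) * |(m : ℝ)| ^ (-(3 / 2) : ℝ)) := by
          gcongr ?_ * (?_ * _)
          · exact base _ (by linarith) (by linarith)
          · exact Real.rpow_le_rpow_of_nonpos hY₀ hY (by norm_num)
      _ = _ := by ring

theorem summable_norm_rpow_mul_weight :
    Summable fun x : ℤˣ × (Fin 2 → ℤ) × ℤ => ‖x.2.1‖ ^ (-(5 / 2) : ℝ) * weight x.2.2 := by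
  have h1 : Summable fun x : (Fin 2 → ℤ) × ℤ => ‖x.1‖ ^ (-(5 / 2) : ℝ) * weight x.2 :=
    (EisensteinSeries.summable_one_div_norm_rpow (by norm_num)).mul_of_nonneg summable_weight
      (fun x => by positivity) weight_nonneg
  have h2 : Summable fun _ : ℤˣ => (1 : ℝ) := (hasSum_fintype _).summable
  have h3 := h2.mul_of_nonneg h1 (fun _ => zero_le_one)
    (fun x => mul_nonneg (by positivity) (weight_nonneg _))
  simpa using h3

theorem summable_slash_cosetElt {k : ℤ} (hk : 4 ≤ k) (N : ℕ) [NeZero N]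
    {Z : Matrix (Fin 2) (Fin 2) ℂ} (hZ : Z ∈ upperLeftHalfSpace) :
    Summable fun x => slash k (phi N) (cosetElt N x).toSp2 Z := by
  have hy : 0 < (Z 0 0).im := hZ.2
  -- The Heisenberg coordinate is recentred at the integer nearest to the real shift, separately for
  -- each ε and (c, d); this is injective on indices.
  set f : ℤˣ × CoprimePair × ℤ → ℤˣ × (Fin 2 → ℤ) × ℤ :=
    fun x => (x.1, x.2.1.1, x.2.2 + round ((x.1 : ℤ) * shift Z x.2.1)) with hf
  have hinj : Function.Injective f := by
    rintro ⟨ε, v, r⟩ ⟨ε', v', r'⟩ h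
    simp only [hf, Prod.mk.injEq] at h
    obtain ⟨rfl, hv, hr⟩ := h
    have hv : v = v' := Subtype.ext hv
    subst hv
    simpa using hr
  set τ : UpperHalfPlane := ⟨Z 0 0, hy⟩ with hτ
  set r := min (EisensteinSeries.r τ) 1
  have hr : 0 < r := lt_min (EisensteinSeries.r_pos τ) one_pos
  -- The 4 pays for the rounding: a nonzero integer n satisfies |n + δ| ≥ |n|/2 when |δ| ≤ 1/2.
  set Y := 2 * Real.pi * N * (Z 0 0).im / 4 with hYdef
  have hN : (0 : ℝ) < N := Nat.cast_pos.2 (NeZero.pos N)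
  have hY : 0 < Y := by positivity
  refine Summable.of_norm_bounded (((summable_norm_rpow_mul_weight.comp_injective hinj).mul_left
    (r ^ (-k : ℝ) * (min Y 1) ^ (-(3 / 4) : ℝ))).mul_left
    (Real.exp (-(2 * Real.pi * N * ((Z 1 1).im - slope Z ^ 2 * (Z 0 0).im))))) ?_
  rintro ⟨ε, v, m⟩
  rw [norm_slash_cosetElt k N hZ]
  refine mul_le_mul_of_nonneg_left ?_ (Real.exp_nonneg _)
  have hP : r * ‖v.1‖ ≤ ‖(v.1 0 : ℂ) * Z 0 0 + v.1 1‖ :=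
    (mul_le_mul_of_nonneg_right (min_le_left _ _) (norm_nonneg _)).trans
      (EisensteinSeries.r_mul_max_le τ v.ne_zero)
  refine le_trans ?_ (zpow_mul_exp_le hk hr (min_le_right _ _) (lt_min hY one_pos)
    (min_le_right Y 1) (min_le_left Y 1) v.one_le_norm hP _)
  have hP0 : 0 < ‖(v.1 0 : ℂ) * Z 0 0 + v.1 1‖ :=
    (mul_pos hr (one_pos.trans_le v.one_le_norm)).trans_le hP
  refine mul_le_mul_of_nonneg_left (Real.exp_le_exp.2 (neg_le_neg
    (div_le_div_of_nonneg_right ?_ (by positivity)))) (by positivity)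
  simp only [hYdef]
  have hs : ((ε : ℤ) : ℝ) * (ε : ℤ) = 1 := by exact_mod_cast Int.units_coe_mul_self ε
  set s := shift Z v
  have h1 : (m * (ε : ℤ) + s) ^ 2 = (m + (ε : ℤ) * s) ^ 2 := by
    linear_combination (m ^ 2 - s ^ 2 : ℝ) * hs
  have h2 : ((m + round ((ε : ℤ) * s) : ℤ) : ℝ) ^ 2 / 4 ≤ (m + (ε : ℤ) * s) ^ 2 := by
    set w := (ε : ℤ) * s
    by_cases h0 : m + round w = 0
    · rw [h0]
      simp
      positivity
    · have ha := abs_sub_round w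
      have hb : (1 : ℝ) ≤ |((m + round w : ℤ) : ℝ)| := by exact_mod_cast Int.one_le_abs h0
      rw [← sq_abs, ← sq_abs (m + w : ℝ)]
      have hc : |((m + round w : ℤ) : ℝ)| ≤ |m + w| + |w - round w| := by
        rw [show ((m + round w : ℤ) : ℝ) = (m + w) - (w - round w) by push_cast; ring]
        exact abs_sub _ _
      have : |((m + round w : ℤ) : ℝ)| / 2 ≤ |m + w| := by linarith
      calc |((m + round w : ℤ) : ℝ)| ^ 2 / 4 = (|((m + round w : ℤ) : ℝ)| / 2) ^ 2 := by ring
        _ ≤ _ := by gcongr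
  rw [h1]
  calc 2 * Real.pi * N * (Z 0 0).im / 4 * ((m + round ((ε : ℤ) * s) : ℤ) : ℝ) ^ 2
      = 2 * Real.pi * N * (Z 0 0).im * (((m + round ((ε : ℤ) * s) : ℤ) : ℝ) ^ 2 / 4) := by ring
    _ ≤ _ := by gcongr

theorem slash_phi_invariant (k : ℤ) (N : ℕ) [NeZero N] {Z : Matrix (Fin 2) (Fin 2) ℂ}
    (hZ : Z ∈ upperLeftHalfSpace) : ∀ γ ∈ translationGroup N, ∀ L ∈ (jacobiGroup N : Set Sp2),
      slash k (phi N) (γ * L) Z = slash k (phi N) L Z := by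
  intro γ hγ L hL
  obtain ⟨P, rfl⟩ := exists_toSp2_of_mem_jacobiGroup hL
  exact slash_phi_translation_mul k N hγ P hZ

theorem summable_slash_rep {k : ℤ} (hk : 4 ≤ k) (N : ℕ) [NeZero N]
    {Z : Matrix (Fin 2) (Fin 2) ℂ} (hZ : Z ∈ upperLeftHalfSpace) :
    Summable fun c : CosetSpace (translationGroup N) (jacobiGroup N) =>
      slash k (phi N) c.rep Z :=
  (((isTransversal_rep _ _).summable_iff_and_tsum_eq (isTransversal_cosetElt N)
    (F := fun L => slash k (phi N) L Z) (slash_phi_invariant k N hZ)).1).2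
    (summable_slash_cosetElt hk N hZ)

/-! ### Nonvanishing -/

/-- The diagonal matrix with entries `i y` and `i`. -/
def diagPoint (y : ℝ) : Matrix (Fin 2) (Fin 2) ℂ := !![y * Complex.I, 0; 0, Complex.I]

theorem diagPoint_mem {y : ℝ} (hy : 0 < y) : diagPoint y ∈ siegelHalfSpace := by
  refine ⟨?_, ?_⟩
  · ext i j
    fin_cases i <;> fin_cases j <;> simp [diagPoint]
  · have : (diagPoint y).map Complex.im = diagonal ![y, 1] := by
      ext i j
      fin_cases i <;> fin_cases j <;> simp [diagPoint]
    rw [this]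
    refine PosDef.diagonal ?_
    intro i
    fin_cases i <;> simp [hy]

theorem norm_slash_cosetElt_diagPoint (k : ℤ) (N : ℕ) {y : ℝ} (hy : 0 < y)
    (x : ℤˣ × CoprimePair × ℤ) :
    ‖slash k (phi N) (cosetElt N x).toSp2 (diagPoint y)‖ =
      Real.exp (-(2 * Real.pi * N)) *
      (‖(x.2.1.1 0 : ℂ) * (y * Complex.I) + x.2.1.1 1‖ ^ (-k) *
        Real.exp (-(2 * Real.pi * N * y * x.2.2 ^ 2 /
          ‖(x.2.1.1 0 : ℂ) * (y * Complex.I) + x.2.1.1 1‖ ^ 2))) := by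
  rw [norm_slash_cosetElt k N (siegelHalfSpace_subset (diagPoint_mem hy))]
  have hs : ((x.1 : ℤ) : ℝ) * (x.1 : ℤ) = 1 := by exact_mod_cast Int.units_coe_mul_self x.1
  have h2 : ((x.2.2 : ℝ) * (x.1 : ℤ)) ^ 2 = x.2.2 ^ 2 := by
    linear_combination (x.2.2 : ℝ) ^ 2 * hs
  simp [shift, slope, diagPoint, h2]

theorem norm_le_norm_denom {y : ℝ} (hy : 1 ≤ y) (v : Fin 2 → ℤ) :
    ‖v‖ ≤ ‖(v 0 : ℂ) * (y * Complex.I) + v 1‖ := by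
  rw [pi_norm_le_iff_of_nonneg (norm_nonneg _)]
  intro i
  rw [Int.norm_eq_abs]
  fin_cases i
  · refine le_trans ?_ (Complex.abs_im_le_norm _)
    simp only [Complex.add_im, Complex.mul_im, Complex.intCast_re, Complex.intCast_im,
      Complex.ofReal_re, Complex.I_im, Complex.ofReal_im, Complex.I_re]
    simp only [mul_one, mul_zero, zero_mul, add_zero, abs_mul]
    exact le_mul_of_one_le_right (abs_nonneg _) (hy.trans (le_abs_self y))
  · refine le_trans ?_ (Complex.abs_re_le_norm _)
    simp

/-- If c ≠ 0, then |cτ+d| ≥ y at τ = iy; if c = 0 and r ≠ 0, then |cτ+d| = 1 and the exponential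
decays in y. Either way the term is at most 1/y. If c = r = 0, the factor (±1)^(-k) is 1 for even k
and the term is constant. -/
theorem tendsto_slash_cosetElt {k : ℤ} (hk : 4 ≤ k) (hk_even : Even k) (N : ℕ) [NeZero N]
    (x : ℤˣ × CoprimePair × ℤ) :
    Filter.Tendsto (fun y : ℝ => slash k (phi N) (cosetElt N x).toSp2 (diagPoint y)) Filter.atTop
      (nhds (Complex.exp (2 * Real.pi * Complex.I * N * Complex.I) *
        ((if x.2.1.1 0 = 0 ∧ x.2.2 = 0 then 1 else 0 : ℝ) : ℂ))) := by
  obtain ⟨ε, v, m⟩ := x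
  have hN : (1 : ℝ) ≤ N := by exact_mod_cast NeZero.one_le
  have hpi : (1 : ℝ) ≤ 2 * Real.pi * N := by nlinarith [Real.pi_gt_three]
  split_ifs with h
  · obtain ⟨hv, hm⟩ := h
    dsimp only at hv hm
    subst hm
    refine Filter.Tendsto.congr' ?_ tendsto_const_nhds
    filter_upwards [Filter.eventually_gt_atTop 0] with y hy
    rw [slash_phi _ _ _ (siegelHalfSpace_subset (diagPoint_mem hy))]
    have hd : v.1 1 = 1 ∨ v.1 1 = -1 := by
      have := v.det_eq_one
      rw [hv, mul_zero, sub_zero] at this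
      exact Int.isUnit_iff.1 (IsUnit.of_mul_eq_one _ (by rwa [mul_comm] at this))
    have h1 : ((ε : ℤ) * v.1 1 : ℂ) ^ (-k) = 1 := by
      have he : Even (-k) := hk_even.neg
      rcases Int.units_eq_one_or ε with rfl | rfl <;> rcases hd with hd | hd <;>
        simp [hd, he.neg_one_zpow]
    simp [cosetElt, ofInt, denom, hv, diagPoint, h1]
  · rw [Complex.ofReal_zero, mul_zero]
    refine squeeze_zero_norm' ?_ tendsto_inv_atTop_zero
    filter_upwards [Filter.eventually_ge_atTop 1] with y hy
    have hy0 : 0 < y := by linarith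
    rw [norm_slash_cosetElt_diagPoint k N hy0]
    dsimp only
    have hP1 := v.one_le_norm.trans (norm_le_norm_denom hy v.1)
    set P := ‖(v.1 0 : ℂ) * (y * Complex.I) + v.1 1‖ with hP
    have hPk : P ^ (-k) ≤ P⁻¹ := by
      rw [← _root_.zpow_neg_one]
      exact zpow_le_zpow_right₀ hP1 (by omega)
    have hPk1 : P ^ (-k) ≤ 1 := hPk.trans (inv_le_one_of_one_le₀ hP1)
    have hE : Real.exp (-(2 * Real.pi * N)) ≤ 1 := Real.exp_le_one_iff.2 (by linarith)
    have key : P ^ (-k) * Real.exp (-(2 * Real.pi * N * y * m ^ 2 / P ^ 2)) ≤ y⁻¹ := by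
      by_cases hv : v.1 0 = 0
      · have hm : m ≠ 0 := fun hm => h ⟨hv, hm⟩
        have hd : v.1 1 = 1 ∨ v.1 1 = -1 := by
          have := v.det_eq_one
          rw [hv, mul_zero, sub_zero] at this
          exact Int.isUnit_iff.1 (IsUnit.of_mul_eq_one _ (by rwa [mul_comm] at this))
        have hP' : P = 1 := by
          rcases hd with hd | hd <;> simp [hP, hv, hd]
        rw [hP']
        simp only [_root_.one_zpow, one_mul, one_pow, div_one, Real.exp_neg]
        have hm2 : (1 : ℝ) ≤ (m : ℝ) ^ 2 := by
          rw [← sq_abs]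
          exact one_le_pow₀ (by exact_mod_cast Int.one_le_abs hm)
        apply inv_anti₀ hy0
        calc y ≤ y + 1 := by linarith
          _ ≤ Real.exp y := Real.add_one_le_exp y
          _ ≤ _ := Real.exp_le_exp.2 (by
            calc y = 1 * y * 1 := by ring
              _ ≤ 2 * Real.pi * N * y * m ^ 2 := by gcongr)
      · have hPy : y ≤ P := by
          refine le_trans ?_ (Complex.abs_im_le_norm _)
          have h1 : (1 : ℝ) ≤ |(v.1 0 : ℝ)| := by exact_mod_cast Int.one_le_abs hv
          simp [abs_mul]
          nlinarith [le_abs_self y]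
        calc P ^ (-k) * Real.exp (-(2 * Real.pi * N * y * m ^ 2 / P ^ 2)) ≤ P⁻¹ * 1 := by
              gcongr
              exact Real.exp_le_one_iff.2 (neg_nonpos.2 (by positivity))
          _ ≤ y⁻¹ := by
              rw [mul_one]
              exact inv_anti₀ hy0 hPy
    calc _ ≤ 1 * y⁻¹ := by gcongr
      _ = y⁻¹ := one_mul _

theorem exists_jacobiEisenstein_ne_zero {k : ℤ} (hk : 4 ≤ k) (hk_even : Even k) (N : ℕ)
    [NeZero N] : ∃ Z ∈ siegelHalfSpace, jacobiEisenstein k N Z ≠ 0 := by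
  have hN : (1 : ℝ) ≤ N := by exact_mod_cast NeZero.one_le
  -- The bound of `zpow_mul_exp_le` with r = Y₀ = 1, which serves all y ≥ 1 at once and so permits
  -- dominated convergence.
  set bound : ℤˣ × CoprimePair × ℤ → ℝ := fun x =>
    Real.exp (-(2 * Real.pi * N)) * ((1 : ℝ) ^ (-k : ℝ) * (1 : ℝ) ^ (-(3 / 4) : ℝ) *
      (‖x.2.1.1‖ ^ (-(5 / 2) : ℝ) * weight x.2.2)) with hbound
  have hinj : Function.Injective (fun x : ℤˣ × CoprimePair × ℤ => (x.1, x.2.1.1, x.2.2)) := by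
    rintro ⟨ε, v, r⟩ ⟨ε', v', r'⟩ h
    simp only [Prod.mk.injEq] at h
    obtain ⟨rfl, hv, rfl⟩ := h
    rw [Subtype.ext hv]
  have hsum : Summable bound :=
    ((summable_norm_rpow_mul_weight.comp_injective hinj).mul_left _).mul_left _
  have hle : ∀ᶠ y : ℝ in Filter.atTop, ∀ x,
      ‖slash k (phi N) (cosetElt N x).toSp2 (diagPoint y)‖ ≤ bound x := by
    filter_upwards [Filter.eventually_ge_atTop 1] with y hy x
    rw [norm_slash_cosetElt_diagPoint k N (by linarith)]
    refine mul_le_mul_of_nonneg_left ?_ (Real.exp_nonneg _)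
    refine zpow_mul_exp_le hk one_pos le_rfl one_pos le_rfl ?_ x.2.1.one_le_norm ?_ _
    · have : (1 : ℝ) ≤ 2 * Real.pi * N := by nlinarith [Real.pi_gt_three]
      nlinarith
    · rw [one_mul]
      exact norm_le_norm_denom hy _
  have hlim := tendsto_slash_cosetElt hk hk_even N
  have htend := tendsto_tsum_of_dominated_convergence hsum hlim hle
  have hE : Complex.exp (2 * Real.pi * Complex.I * N * Complex.I) ≠ 0 := Complex.exp_ne_zero _
  set g : ℤˣ × CoprimePair × ℤ → ℝ := fun x => if x.2.1.1 0 = 0 ∧ x.2.2 = 0 then 1 else 0 with hg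
  have hgs : Summable g := by
    have h1 : Summable fun x => Complex.exp (2 * Real.pi * Complex.I * N * Complex.I) *
        ((g x : ℝ) : ℂ) := by
      refine Summable.of_norm_bounded hsum fun x => ?_
      exact le_of_tendsto (hlim x).norm (hle.mono fun y hy => hy x)
    exact Complex.summable_ofReal.1 ((summable_mul_left_iff hE).1 h1)
  have hpos : 0 < ∑' x, g x := by
    refine hgs.tsum_pos (fun x => ?_) (1, ⟨![0, 1], isCoprime_one_right⟩, 0) ?_
    · simp only [hg]
      positivity
    · simp [hg]
  have hne : ∑' x, Complex.exp (2 * Real.pi * Complex.I * N * Complex.I) * ((g x : ℝ) : ℂ) ≠ 0 := by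
    rw [tsum_mul_left, ← Complex.ofReal_tsum]
    exact mul_ne_zero hE (Complex.ofReal_ne_zero.2 hpos.ne')
  obtain ⟨y, hy, hy0⟩ := ((htend.eventually_ne hne).and (Filter.eventually_gt_atTop 0)).exists
  refine ⟨diagPoint y, diagPoint_mem hy0, ?_⟩
  rw [jacobiEisenstein, ((isTransversal_rep _ _).summable_iff_and_tsum_eq (isTransversal_cosetElt N)
    (F := fun L => slash k (phi N) L (diagPoint y))
    (slash_phi_invariant k N (siegelHalfSpace_subset (diagPoint_mem hy0)))).2]
  exact mul_ne_zero (by norm_num) hy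

/-! ### Finiteness of the Hecke double coset -/

theorem heckeMatrix_val (q : ℕ) (hq : q ≠ 0) :
    (heckeMatrix q hq).1 = diagonal (Sum.elim ![(q : ℝ)⁻¹, 1] ![(q : ℝ), 1]) := by
  have h : (q : ℝ) ≠ 0 := Nat.cast_ne_zero.2 hq
  ext i j
  rcases i with i | i <;> rcases j with j | j <;> fin_cases i <;> fin_cases j <;>
      (simp [heckeMatrix, h]; try field_simp)

theorem heckeMatrix_inv_val (q : ℕ) (hq : q ≠ 0) :
    ((heckeMatrix q hq)⁻¹).1 = diagonal (Sum.elim ![(q : ℝ), 1] ![(q : ℝ)⁻¹, 1]) := by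
  rw [coe_inv_apply, heckeMatrix_val q hq]
  ext i j
  rcases i with i | i <;> rcases j with j | j <;> fin_cases i <;> fin_cases j <;>
      simp [toBlocks₁₁, toBlocks₁₂, toBlocks₂₁, toBlocks₂₂]

theorem heckeMatrix_conj_apply (q : ℕ) (hq : q ≠ 0) (M : Sp2) (i j : Fin 2 ⊕ Fin 2) :
    (heckeMatrix q hq * M * (heckeMatrix q hq)⁻¹).1 i j =
      Sum.elim ![(q : ℝ)⁻¹, 1] ![(q : ℝ), 1] i * M.1 i j *
        Sum.elim ![(q : ℝ), 1] ![(q : ℝ)⁻¹, 1] j := by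
  change ((heckeMatrix q hq).1 * M.1 * ((heckeMatrix q hq)⁻¹).1) i j = _
  rw [heckeMatrix_val, heckeMatrix_inv_val, mul_diagonal, diagonal_mul]

/-- Conjugation by K multiplies each entry by a power of q between q^(-2) and q², so congruence to 1
modulo q² leaves the entries in the paramodular lattice. -/
theorem heckeMatrix_conj_mem {N : ℕ} [NeZero N] {q : ℕ} (hq : q ≠ 0) {M : Sp2}
    (hM : M ∈ jacobiGroup N)
    (h : ∀ i j, ∃ n : ℤ, M.1 i j - (1 : Matrix _ _ ℝ) i j = scale N i j * ((q : ℝ) ^ 2 * n)) :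
    heckeMatrix q hq * M * (heckeMatrix q hq)⁻¹ ∈ jacobiGroup N := by
  have hq' : (q : ℝ) ≠ 0 := Nat.cast_ne_zero.2 hq
  obtain ⟨-, h1, h2, h3, h4, h5, h6, h7⟩ := hM
  refine ⟨fun i j => ?_, ?_⟩
  · obtain ⟨n, hn⟩ := h i j
    rw [heckeMatrix_conj_apply, sub_eq_iff_eq_add.1 hn]
    by_cases hij : i = j
    · subst hij
      refine ⟨q ^ 2 * n + 1, ?_⟩
      rcases i with i | i <;> fin_cases i <;> simp [scale] <;> field_simp
    · rw [one_apply_ne hij, add_zero]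
      obtain ⟨e, he⟩ : ∃ e : ℤ, Sum.elim ![(q : ℝ)⁻¹, 1] ![(q : ℝ), 1] i * (q : ℝ) ^ 2 *
          Sum.elim ![(q : ℝ), 1] ![(q : ℝ)⁻¹, 1] j = e := by
        rcases i with i | i <;> rcases j with j | j <;> fin_cases i <;> fin_cases j <;>
          first
          | (refine ⟨1, ?_⟩; simp; field_simp; done)
          | (refine ⟨q, ?_⟩; simp; field_simp; done)
          | (refine ⟨q ^ 2, ?_⟩; simp [mul_right_comm, hq']; done)
          | (refine ⟨q ^ 3, ?_⟩; simp; ring; done)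
          | (refine ⟨q ^ 4, ?_⟩; simp; ring; done)
      refine ⟨e * n, ?_⟩
      push_cast
      rw [← he]
      ring
  · simp [heckeMatrix_conj_apply, h1, h2, h3, h4, h5, h6, h7]

/-- The coset of KM depends only on the rescaled entries of M modulo q²: if M ≡ M', then K(MM'⁻¹)K⁻¹
lies in the Jacobi group. -/
theorem finite_cosetSpace_heckeMatrix (N : ℕ) [NeZero N] (q : ℕ) (hq : q ≠ 0) :
    Finite (CosetSpace (jacobiGroup N) (doubleCoset (jacobiGroup N) (heckeMatrix q hq))) := by
  have : NeZero (q ^ 2) := ⟨pow_ne_zero 2 hq⟩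
  have hT := isTransversal_rep (jacobiGroup N) (doubleCoset (jacobiGroup N) (heckeMatrix q hq))
  have hmem : ∀ c : CosetSpace (jacobiGroup N) (doubleCoset (jacobiGroup N) (heckeMatrix q hq)),
      ∃ j ∈ jacobiGroup N, ∃ M ∈ jacobiGroup N, c.rep = j * heckeMatrix q hq * M := fun c => by
    obtain ⟨x, hx, y, hy, h⟩ := DoubleCoset.mem_doubleCoset.1 (hT.mem c)
    exact ⟨x, hx, y, hy, h⟩
  choose j hj M hM hc using hmem
  choose n hn using fun c => (hM c).1
  refine Finite.of_injective (fun c i l => ((n c i l : ℤ) : ZMod (q ^ 2))) fun c c' h => ?_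
  have hdvd : ∀ i l, ∃ e : ℤ, n c i l - n c' i l = q ^ 2 * e := fun i l => by
    have h' := congrFun (congrFun h i) l
    obtain ⟨e, he⟩ := (ZMod.intCast_eq_intCast_iff_dvd_sub _ _ _).1 h'.symm
    exact ⟨e, by rw [he]; push_cast; ring⟩
  choose e he using hdvd
  have hcong : ∀ i l, ∃ m : ℤ, (M c * (M c')⁻¹).1 i l - (1 : Matrix _ _ ℝ) i l =
      scale N i l * ((q : ℝ) ^ 2 * m) := fun i l => by
    choose b hb using (inv_mem (hM c')).1
    choose s hs using fun r => scale_mul N i r l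
    refine ⟨∑ r, s r * e i r * b r l, ?_⟩
    have h1 : (1 : Matrix (Fin 2 ⊕ Fin 2) (Fin 2 ⊕ Fin 2) ℝ) = (M c').1 * ((M c')⁻¹).1 :=
      (congrArg Subtype.val (mul_inv_cancel (M c'))).symm
    rw [h1]
    change ((M c).1 * ((M c')⁻¹).1) i l - ((M c').1 * ((M c')⁻¹).1) i l = _
    rw [Matrix.mul_apply, Matrix.mul_apply, ← Finset.sum_sub_distrib, Int.cast_sum,
      Finset.mul_sum, Finset.mul_sum]
    refine Finset.sum_congr rfl fun r _ => ?_
    have he' : (n c i r - n c' i r : ℝ) = q ^ 2 * e i r := by exact_mod_cast he i r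
    rw [hn, hn, hb]
    push_cast
    linear_combination (scale N i r * scale N r l * b r l : ℝ) * he' +
      ((q : ℝ) ^ 2 * e i r * b r l) * hs r
  refine hT.inj c c' (j c * (heckeMatrix q hq * (M c * (M c')⁻¹) * (heckeMatrix q hq)⁻¹) *
    (j c')⁻¹) (mul_mem (mul_mem (hj c) (heckeMatrix_conj_mem hq
      (mul_mem (hM c) (inv_mem (hM c'))) hcong)) (inv_mem (hj c'))) ?_
  rw [hc, hc]
  group

/-! ### Coset representatives of the Hecke double coset modulo translations -/

/-- Index type of the representatives `heckeRep`. -/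
abbrev HeckeIndex (q : ℕ) : Type :=
  Unit ⊕ (Fin (q - 1) × Fin q) ⊕ (Fin q × Fin (q ^ 2) × Fin q)

/-- The unipotent element `(1 s; 0 1)` multiplied from the left by a Heisenberg element. -/
def unip (l s : ℝ) : JacobiElt where
  a := 1
  b := s
  c := 0
  d := 1
  l := l
  m := l * s
  κ := 0
  ε := 1
  det := by simp
  sq := by simp

/-- The element `diag(1/t, 1, t, 1)` multiplied from the left by a Heisenberg element and from
the right by a translation. -/
def contraction (t : ℝ) (ht : t ≠ 0) (l s u : ℝ) : JacobiElt where
  a := 1 / t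
  b := s / t
  c := 0
  d := t
  l := l / t
  m := l * s / t + u
  κ := l * u / t
  ε := 1
  det := by simp [ht]
  sq := by simp

/-- Representatives of the Hecke double coset modulo translations from the left and the Jacobi
group from the right. -/
def heckeRep (q : ℕ) (hq : q ≠ 0) : HeckeIndex q → JacobiElt
  | .inl _ => dil q (Nat.cast_ne_zero.2 hq)
  | .inr (.inl (s, l)) => unip (l : ℕ) (((s : ℕ) + 1 : ℕ) / q)
  | .inr (.inr (l, s, u)) =>
    contraction q (Nat.cast_ne_zero.2 hq) (l : ℕ) (s : ℕ) (u : ℕ)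

section

variable {N : ℕ} [NeZero N] {q : ℕ}

/-- In SL₂, with xq + yβ = 1, one has (1 β/q; 0 1) = (β -x; q y) · diag(1/q, q) · (yq 1; -1 0). -/
theorem unip_mem_doubleCoset (hq : q.Prime) {β : ℤ} (hβ : ¬ (q : ℤ) ∣ β) (l : ℤ) :
    (unip l (β / q)).toSp2 ∈ doubleCoset (jacobiGroup N) (heckeMatrix q hq.ne_zero) := by
  have h0 : (q : ℝ) ≠ 0 := Nat.cast_ne_zero.2 hq.ne_zero
  obtain ⟨x, y, hxy⟩ : IsCoprime (q : ℤ) β :=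
    (Nat.prime_iff_prime_int.1 hq).irreducible.coprime_iff_not_dvd.2 hβ
  have hxy' : (x * q + y * β : ℝ) = 1 := by exact_mod_cast hxy
  refine DoubleCoset.mem_doubleCoset.2
    ⟨(ofInt N β (-x) q y (l * β) (-l * x) 0 1 (by linear_combination hxy)).toSp2,
      mem_jacobiGroup_iff.2 ⟨_, _, _, _, _, _, _, _, _, rfl⟩,
    (ofInt N (y * q) 1 (-1) 0 0 0 0 1 (by ring)).toSp2,
      mem_jacobiGroup_iff.2 ⟨_, _, _, _, _, _, _, _, _, rfl⟩, ?_⟩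
  rw [heckeMatrix_eq, ← toSp2_mul, ← toSp2_mul]
  congr 1
  ext <;> simp [mul_def, ofInt, dil, unip] <;> field_simp <;> grind

theorem heckeRep_mem (hq : q.Prime) (r : HeckeIndex q) :
    (heckeRep q hq.ne_zero r).toSp2 ∈
      doubleCoset (jacobiGroup N) (heckeMatrix q hq.ne_zero) := by
  have h0 : (q : ℝ) ≠ 0 := Nat.cast_ne_zero.2 hq.ne_zero
  rcases r with _ | ⟨s, l⟩ | ⟨l, s, u⟩
  · refine DoubleCoset.mem_doubleCoset.2
      ⟨(ofInt N 0 1 (-1) 0 0 0 0 1 (by ring)).toSp2,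
        mem_jacobiGroup_iff.2 ⟨_, _, _, _, _, _, _, _, _, rfl⟩,
      (ofInt N 0 (-1) 1 0 0 0 0 1 (by ring)).toSp2,
        mem_jacobiGroup_iff.2 ⟨_, _, _, _, _, _, _, _, _, rfl⟩, ?_⟩
    rw [heckeMatrix_eq, ← toSp2_mul, ← toSp2_mul]
    congr 1
    ext <;> simp [heckeRep, mul_def, ofInt, dil]
  · have h := unip_mem_doubleCoset (N := N) hq (β := (s : ℕ) + 1) (by
      intro h
      have := Int.le_of_dvd (by omega) h
      omega) (l : ℕ)
    simpa [heckeRep] using h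
  · refine DoubleCoset.mem_doubleCoset.2
      ⟨(ofInt N 1 0 0 1 (l : ℕ) 0 0 1 (by ring)).toSp2,
        mem_jacobiGroup_iff.2 ⟨_, _, _, _, _, _, _, _, _, rfl⟩,
      (ofInt N 1 (s : ℕ) 0 1 0 (u : ℕ) 0 1 (by ring)).toSp2,
        mem_jacobiGroup_iff.2 ⟨_, _, _, _, _, _, _, _, _, rfl⟩, ?_⟩
    rw [heckeMatrix_eq, ← toSp2_mul, ← toSp2_mul]
    congr 1
    ext <;> simp [heckeRep, mul_def, ofInt, dil, contraction] <;> field_simp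

/-- The union of the cosets ΓR is stable under Γ on the right, so the products of the R with
representatives of Γ\J do not depend on those representatives as a set of cosets. A contraction is
moved to another one, with s changed modulo q² and u modulo q; the other two families keep R. -/
theorem exists_heckeRep_mul_translation (hq : q ≠ 0) (r : HeckeIndex q) {γ : Sp2}
    (hγ : γ ∈ translationGroup N) : ∃ r', ∃ δ ∈ translationGroup N,
      (heckeRep q hq r).toSp2 * γ = δ * (heckeRep q hq r').toSp2 := by
  have h0 : (q : ℝ) ≠ 0 := Nat.cast_ne_zero.2 hq
  have hN : (N : ℝ) ≠ 0 := Nat.cast_ne_zero.2 (NeZero.ne N)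
  obtain ⟨s', t', u', rfl⟩ := mem_translationGroup_iff.1 hγ
  rcases r with _ | ⟨s, l⟩ | ⟨l, s, u⟩
  · refine ⟨.inl (), _, mem_translationGroup_iff.2 ⟨q ^ 2 * s', q * t', u', rfl⟩, ?_⟩
    rw [← toSp2_mul, ← toSp2_mul]
    congr 1
    ext <;> simp [heckeRep, mul_def, transl, dil] <;> field_simp
  · refine ⟨.inr (.inl (s, l)), _, mem_translationGroup_iff.2
      ⟨s', t' + (l : ℕ) * s', u' + N * (2 * (l : ℕ) * t' + (l : ℕ) ^ 2 * s'), rfl⟩, ?_⟩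
    rw [← toSp2_mul, ← toSp2_mul]
    congr 1
    ext <;> simp [heckeRep, mul_def, transl, unip] <;> field_simp <;> ring
  · obtain ⟨s₁, hs₁⟩ : ∃ i : Fin (q ^ 2), ((i : ℕ) : ℤ) = ((s : ℕ) + s') % (q ^ 2 : ℕ) := by
      have hpos : (0 : ℤ) < (q ^ 2 : ℕ) := by positivity
      have h1 := Int.emod_nonneg ((s : ℕ) + s') hpos.ne'
      have h2 := Int.emod_lt_of_pos ((s : ℕ) + s') hpos
      exact ⟨⟨(((s : ℕ) + s') % (q ^ 2 : ℕ)).toNat, by omega⟩, by simp only; omega⟩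
    obtain ⟨u₁, hu₁⟩ : ∃ i : Fin q, ((i : ℕ) : ℤ) = ((u : ℕ) + t') % q := by
      have hpos : (0 : ℤ) < q := by positivity
      have h1 := Int.emod_nonneg ((u : ℕ) + t') hpos.ne'
      have h2 := Int.emod_lt_of_pos ((u : ℕ) + t') hpos
      exact ⟨⟨(((u : ℕ) + t') % q).toNat, by omega⟩, by simp only; omega⟩
    set e := ((s : ℕ) + s') / (q ^ 2 : ℕ) with he
    set f := ((u : ℕ) + t') / (q : ℤ) with hf
    have hs₂ : ((s : ℕ) + s' : ℝ) = (s₁ : ℕ) + q ^ 2 * e := by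
      have := Int.emod_add_mul_ediv ((s : ℕ) + s') (q ^ 2 : ℕ)
      rw [← hs₁, ← he] at this
      exact_mod_cast this.symm
    have hu₂ : ((u : ℕ) + t' : ℝ) = (u₁ : ℕ) + q * f := by
      have := Int.emod_add_mul_ediv ((u : ℕ) + t') q
      rw [← hu₁, ← hf] at this
      exact_mod_cast this.symm
    refine ⟨.inr (.inr (l, s₁, u₁)), _, mem_translationGroup_iff.2
      ⟨e, (l : ℕ) * e + f, u' + N * ((l : ℕ) * f + (l : ℕ) * ((l : ℕ) * e + f)), rfl⟩, ?_⟩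
    rw [← toSp2_mul, ← toSp2_mul]
    congr 1
    ext
    · simp [heckeRep, mul_def, transl, contraction]
    · simp [heckeRep, mul_def, transl, contraction]
      field_simp
      linear_combination hs₂
    · simp [heckeRep, mul_def, transl, contraction]
    · simp [heckeRep, mul_def, transl, contraction]
    · simp [heckeRep, mul_def, transl, contraction]
    · simp [heckeRep, mul_def, transl, contraction]
      field_simp
      linear_combination ((l : ℕ) : ℝ) * hs₂ + q * hu₂
    · simp [heckeRep, mul_def, transl, contraction]
      field_simp
      linear_combination (N * (l : ℕ) : ℝ) * hu₂
    · simp [heckeRep, mul_def, transl, contraction]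

/-- The bottom row of the SL₂ part of MK is (c, dq²)/q. Dividing (c, dq²) by gcd(c, q²) gives a
coprime row; completing it to an integral matrix and splitting that off on the right leaves an upper
triangular factor with diagonal (q, 1/q), (1, 1) or (1/q, q). -/
theorem exists_heckeRep_of_jacobiGroup (hq : q.Prime) {M : Sp2} (hM : M ∈ jacobiGroup N) :
    ∃ r, ∃ γ ∈ translationGroup N, ∃ j ∈ jacobiGroup N,
      M * heckeMatrix q hq.ne_zero = γ * ((heckeRep q hq.ne_zero r).toSp2 * j) := by
  have h0 : (q : ℝ) ≠ 0 := Nat.cast_ne_zero.2 hq.ne_zero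
  have hN : (N : ℝ) ≠ 0 := Nat.cast_ne_zero.2 (NeZero.ne N)
  have hprime : Prime (q : ℤ) := Nat.prime_iff_prime_int.1 hq
  have hpos : (0 : ℤ) < q := by exact_mod_cast hq.pos
  have hmod : ∀ x : ℤ, ∃ (i : Fin q) (e : ℤ), x = (i : ℕ) + q * e := fun x => by
    have h1 := Int.emod_nonneg x hpos.ne'
    have h2 := Int.emod_lt_of_pos x hpos
    refine ⟨⟨(x % q).toNat, by omega⟩, x / q, ?_⟩
    have := Int.emod_add_mul_ediv x q
    simp only
    omega
  obtain ⟨⟨ε, v, x⟩, γ, hγ, rfl⟩ := (isTransversal_cosetElt N).surj M hM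
  suffices h : ∃ r, ∃ γ ∈ translationGroup N, ∃ j ∈ jacobiGroup N,
      (cosetElt N (ε, v, x)).toSp2 * heckeMatrix q hq.ne_zero =
        γ * ((heckeRep q hq.ne_zero r).toSp2 * j) by
    obtain ⟨r, δ, hδ, j, hj, h⟩ := h
    exact ⟨r, γ * δ, mul_mem hγ hδ, j, hj, by rw [mul_assoc, h, mul_assoc]⟩
  have hdet := v.det_eq_one
  have hcE : cosetElt N (ε, v, x) = ofInt N v.topLeft v.topRight (v.1 0) (v.1 1) (x * v.topLeft)
    (x * v.topRight) 0 ε hdet := rfl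
  rw [hcE]
  generalize v.topLeft = a, v.topRight = b, v.1 0 = c, v.1 1 = d at hdet ⊢
  have hdetR : (a * d - b * c : ℝ) = 1 := by exact_mod_cast hdet
  rw [heckeMatrix_eq]
  by_cases hc : (q : ℤ) ∣ c
  · obtain ⟨c₁, rfl⟩ := hc
    by_cases hc₁ : (q : ℤ) ∣ c₁
    · obtain ⟨c₂, rfl⟩ := hc₁
      obtain ⟨i, e, hx⟩ := hmod x
      have hx' : (x : ℝ) = (i : ℕ) + q * e := by exact_mod_cast hx
      have hq2 : 0 < q ^ 2 := pow_pos hq.pos 2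
      refine ⟨.inr (.inr (i, ⟨0, hq2⟩, ⟨0, hq.pos⟩)), 1, one_mem _, _,
        mem_jacobiGroup_iff.2 ⟨a, b * q ^ 2, c₂, d, e * a, e * (b * q ^ 2), 0, ε,
          by linear_combination hdet, rfl⟩, ?_⟩
      rw [one_mul, ← toSp2_mul, ← toSp2_mul]
      congr 1
      ext <;> simp [heckeRep, mul_def, ofInt, contraction, dil, hx'] <;> field_simp <;> ring_nf
      simp
    · have hcop : IsCoprime (d * q) c₁ := by
        refine IsCoprime.mul_left ⟨a, -(b * q), by linear_combination hdet⟩ ?_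
        exact hprime.irreducible.coprime_iff_not_dvd.2 hc₁
      obtain ⟨a₀, b₁, hab⟩ := hcop
      obtain ⟨b₀, rfl⟩ : ∃ b₀, b₁ = -b₀ := ⟨-b₁, by ring⟩
      have habR : (a₀ * (d * q) + -b₀ * c₁ : ℝ) = 1 := by exact_mod_cast hab
      -- σ/q is the upper right entry left after splitting off (a₀ b₀; c₁ dq). It is not integral,
      -- since q divides neither a nor b₀; its class modulo 1 selects the unipotent representative.
      set σ := b * a₀ * q ^ 2 - a * b₀ with hσ
      have hσq : ¬ (q : ℤ) ∣ σ := by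
        intro h
        have h1 : (q : ℤ) ∣ a * b₀ := by
          have : a * b₀ = q * (b * a₀ * q) - σ := by rw [hσ]; ring
          rw [this]
          exact dvd_sub (dvd_mul_right _ _) h
        rcases hprime.dvd_or_dvd h1 with h2 | h2
        · have : (q : ℤ) ∣ 1 := by
            rw [← hdet]
            exact dvd_sub (h2.mul_right _) ((dvd_mul_right _ _).mul_left _)
          exact hprime.not_dvd_one this
        · have : (q : ℤ) ∣ 1 := by
            rw [← hab]
            exact dvd_add ((dvd_mul_left _ _).mul_left _) ((dvd_neg.2 h2).mul_right _)
          exact hprime.not_dvd_one this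
      obtain ⟨β, s, hβ⟩ := hmod σ
      have hβ0 : (β : ℕ) ≠ 0 := by
        intro h
        rw [h] at hβ
        exact hσq ⟨s, by rw [hβ]; simp⟩
      obtain ⟨i, e, hx⟩ := hmod x
      have hx' : (x : ℝ) = (i : ℕ) + q * e := by exact_mod_cast hx
      have hβ' : (b * a₀ * q ^ 2 - a * b₀ : ℝ) = (β : ℕ) + q * s := by
        rw [hσ] at hβ
        exact_mod_cast hβ
      have hβlt := β.2
      -- The index s in `Fin (q - 1)` stands for the numerator s + 1, hence β - 1.
      refine ⟨.inr (.inl (⟨β - 1, by omega⟩, i)), _, mem_translationGroup_iff.2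
        ⟨s, (i : ℕ) * s, N * (i : ℕ) ^ 2 * s, rfl⟩, _,
        mem_jacobiGroup_iff.2 ⟨a₀, b₀, c₁, d * q, e * a, e * (b * q ^ 2), 0, ε,
          by linear_combination hab, rfl⟩, ?_⟩
      have hβ1 : ((β : ℕ) - 1 : ℕ) + 1 = (β : ℕ) := by omega
      rw [← toSp2_mul, ← toSp2_mul, ← toSp2_mul]
      congr 1
      have hβ2 : ((β : ℕ) : ℝ) = b * a₀ * q ^ 2 - a * b₀ - q * s := by linear_combination -hβ'
      push_cast at hdetR
      ext
      · simp [heckeRep, mul_def, ofInt, unip, dil, transl, hβ1, hβ2]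
        field_simp
        grind
      · simp [heckeRep, mul_def, ofInt, unip, dil, transl, hβ1, hβ2]
        field_simp
        grind
      · simp [heckeRep, mul_def, ofInt, unip, dil, transl]
        field_simp
      · simp [heckeRep, mul_def, ofInt, unip, dil, transl]
      · simp [heckeRep, mul_def, ofInt, unip, dil, transl, hβ1, hβ2, hx']
        field_simp
        grind
      · simp [heckeRep, mul_def, ofInt, unip, dil, transl, hβ1, hβ2, hx']
        field_simp
        grind
      · simp [heckeRep, mul_def, ofInt, unip, dil, transl, hβ1, hβ2]
        field_simp
        grind
      · simp [heckeRep, mul_def, ofInt, unip, dil, transl]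
  · have hcop : IsCoprime (d * q ^ 2) c := by
      refine IsCoprime.mul_left ⟨a, -b, by linear_combination hdet⟩ ?_
      exact (hprime.irreducible.coprime_iff_not_dvd.2 hc).pow_left
    obtain ⟨a₀, b₁, hab⟩ := hcop
    obtain ⟨b₀, rfl⟩ : ∃ b₀, b₁ = -b₀ := ⟨-b₁, by ring⟩
    have habR : (a₀ * (d * q ^ 2) + -b₀ * c : ℝ) = 1 := by exact_mod_cast hab
    set s := b * a₀ * q ^ 2 - a * b₀ with hs
    refine ⟨.inl (), _, mem_translationGroup_iff.2 ⟨s, x * s, N * x ^ 2 * s, rfl⟩, _,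
      mem_jacobiGroup_iff.2 ⟨a₀, b₀, c, d * q ^ 2, x * q * a₀, x * q * b₀, 0, ε,
        by linear_combination hab, rfl⟩, ?_⟩
    rw [← toSp2_mul, ← toSp2_mul, ← toSp2_mul]
    congr 1
    ext
    · simp [heckeRep, mul_def, ofInt, dil, transl, hs]
      field_simp
      grind
    · simp [heckeRep, mul_def, ofInt, dil, transl, hs]
      field_simp
      grind
    · simp [heckeRep, mul_def, ofInt, dil, transl]
      field_simp
    · simp [heckeRep, mul_def, ofInt, dil, transl]
      field_simp
    · simp [heckeRep, mul_def, ofInt, dil, transl, hs]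
      field_simp
      grind
    · simp [heckeRep, mul_def, ofInt, dil, transl, hs]
      field_simp
      grind
    · simp [heckeRep, mul_def, ofInt, dil, transl, hs]
      field_simp
      grind
    · simp [heckeRep, mul_def, ofInt, dil, transl]

end

theorem heckeRep_c (q : ℕ) (hq : q ≠ 0) (r : HeckeIndex q) : (heckeRep q hq r).c = 0 := by
  rcases r with _ | _ | _ <;> rfl

theorem heckeRep_ε (q : ℕ) (hq : q ≠ 0) (r : HeckeIndex q) : (heckeRep q hq r).ε = 1 := by
  rcases r with _ | _ | _ <;> rfl

theorem heckeRep_a_pos (q : ℕ) (hq : q ≠ 0) (r : HeckeIndex q) : 0 < (heckeRep q hq r).a := by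
  have h : (0 : ℝ) < q := Nat.cast_pos.2 (Nat.pos_of_ne_zero hq)
  rcases r with _ | _ | _ <;> simp [heckeRep, dil, unip, contraction, h]

theorem heckeRep_d_ne_zero (q : ℕ) (hq : q ≠ 0) (r : HeckeIndex q) :
    (heckeRep q hq r).d ≠ 0 := by
  have h : (q : ℝ) ≠ 0 := Nat.cast_ne_zero.2 hq
  rcases r with _ | _ | _ <;> simp [heckeRep, dil, unip, contraction, h]

theorem eq_of_eq_add_mul {x y n : ℕ} (hx : x < n) (hy : y < n) {z : ℤ}
    (h : (x : ℤ) = y + n * z) : x = y := by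
  have h1 : (x : ℤ) % n = y % n := by rw [h]; simp
  rw [Int.emod_eq_of_lt (by omega) (by omega), Int.emod_eq_of_lt (by omega) (by omega)] at h1
  exact_mod_cast h1

/-- Both representatives are upper triangular with positive a and sign 1, which makes j unipotent;
the value of a then separates the three families. Equality of indices needs j = 1, because a
translation j may permute the contractions. -/
theorem heckeRep_eq_mul {N : ℕ} [NeZero N] {q : ℕ} (hq : q.Prime) {r r' : HeckeIndex q}
    {γ j : Sp2} (hγ : γ ∈ translationGroup N) (hj : j ∈ jacobiGroup N)
    (h : (heckeRep q hq.ne_zero r).toSp2 = γ * ((heckeRep q hq.ne_zero r').toSp2 * j)) :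
    j ∈ translationGroup N ∧ (j = 1 → r = r') := by
  have h0 : (q : ℝ) ≠ 0 := Nat.cast_ne_zero.2 hq.ne_zero
  have hq1 : (1 : ℝ) < q := by exact_mod_cast hq.one_lt
  obtain ⟨s, t, u, rfl⟩ := mem_translationGroup_iff.1 hγ
  obtain ⟨a, b, c, d, l, m, κ, ε, hdet, rfl⟩ := mem_jacobiGroup_iff.1 hj
  rw [← toSp2_mul, ← toSp2_mul] at h
  have h := toSp2_injective h
  have ha := congrArg JacobiElt.a h
  have hb := congrArg JacobiElt.b h
  have hc := congrArg JacobiElt.c h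
  have hl := congrArg JacobiElt.l h
  have hm := congrArg JacobiElt.m h
  have hε := congrArg JacobiElt.ε h
  simp only [mul_def, transl, ofInt, heckeRep_c, heckeRep_ε, zero_mul, one_mul, zero_add]
    at ha hb hc hl hm hε
  have hc0 : c = 0 := by
    rcases mul_eq_zero.1 hc.symm with h | h
    · exact absurd h (heckeRep_d_ne_zero _ _ _)
    · exact_mod_cast h
  subst hc0
  have hε1 : ε = 1 := Units.ext (Int.cast_eq_one.1 hε.symm)
  subst hε1
  simp only [Int.cast_zero, mul_zero, add_zero] at ha hl
  have ha0 : 0 < a := by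
    have h1 := heckeRep_a_pos q hq.ne_zero r
    rw [ha] at h1
    exact_mod_cast (pos_iff_pos_of_mul_pos h1).1 (heckeRep_a_pos q hq.ne_zero r')
  have ha1 : a = 1 := by
    rcases Int.isUnit_iff.1 (IsUnit.of_mul_eq_one d (by linarith : a * d = 1)) with h | h
    · exact h
    · omega
  subst ha1
  have hd1 : d = 1 := by linarith
  subst hd1
  simp only [Int.cast_one, mul_one] at ha hb hl hm
  have hqinv : (q : ℝ)⁻¹ < 1 := inv_lt_one_of_one_lt₀ hq1
  have key : l = 0 ∧ (b = 0 → m = 0 → r = r') := by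
    rcases r with _ | ⟨β, i⟩ | ⟨i, β, μ⟩ <;> rcases r' with _ | ⟨β', i'⟩ | ⟨i', β', μ'⟩ <;>
      simp [heckeRep, dil, unip, contraction] at ha hb hl hm
    · exact ⟨by exact_mod_cast hl.symm, fun _ _ => rfl⟩
    · exact absurd ha hq.one_lt.ne'
    · linarith
    · linarith
    · have hβ : ((β + 1 : ℕ) : ℤ) = (β' + 1 : ℕ) + q * (b + s) := by
        have : ((β + 1 : ℕ) : ℝ) = (β' + 1 : ℕ) + q * (b + s) := by
          push_cast
          field_simp at hb
          linear_combination hb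
        exact_mod_cast this
      have hβ₁ : (β : ℕ) = β' := by
        have h1 := eq_of_eq_add_mul (by omega) (by omega) hβ
        omega
      -- Comparing the second Heisenberg coordinates gives this divisibility; as 0 < β + 1 < q, it
      -- forces q ∣ l, so the two residues i and i' agree.
      have hdvd : (q : ℤ) ∣ l * (β + 1 : ℕ) := by
        have hl' : (l : ℝ) = (i : ℕ) - (i' : ℕ) := by linear_combination -hl
        refine ⟨i' * b + t + m, ?_⟩
        have : ((l * (β + 1 : ℕ) : ℤ) : ℝ) = ((q * ((i' : ℕ) * b + t + m) : ℤ) : ℝ) := by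
          push_cast
          rw [hl']
          rw [← hβ₁] at hm
          field_simp at hm
          linear_combination hm
        exact_mod_cast this
      have hlq : (q : ℤ) ∣ l := by
        rcases (Nat.prime_iff_prime_int.1 hq).dvd_or_dvd hdvd with h | h
        · exact h
        · have := Nat.le_of_dvd (by omega) (Int.natCast_dvd_natCast.1 h)
          omega
      obtain ⟨e, rfl⟩ := hlq
      have hi : ((i : ℕ) : ℤ) = (i' : ℕ) + q * e := by
        have : ((i : ℕ) : ℝ) = (i' : ℕ) + q * e := by
          push_cast at hl
          linear_combination hl
        exact_mod_cast this
      have hi₁ := eq_of_eq_add_mul i.2 i'.2 hi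
      refine ⟨by omega, fun _ _ => ?_⟩
      rw [Fin.ext hβ₁, Fin.ext hi₁]
    · exact absurd ha hq.one_lt.ne'
    · linarith
    · exact absurd ha hq.one_lt.ne'
    · have hi : ((i : ℕ) : ℤ) = (i' : ℕ) + q * l := by
        have : ((i : ℕ) : ℝ) = (i' : ℕ) + q * l := by
          field_simp at hl
          linear_combination hl
        exact_mod_cast this
      have hi₁ := eq_of_eq_add_mul i.2 i'.2 hi
      have hl0 : l = 0 := by
        rw [hi₁] at hi
        have : (q : ℤ) * l = 0 := by omega
        exact (mul_eq_zero.1 this).resolve_left (by exact_mod_cast hq.ne_zero)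
      refine ⟨hl0, ?_⟩
      rintro rfl rfl
      have hβ : ((β : ℕ) : ℤ) = (β' : ℕ) + (q ^ 2 : ℕ) * s := by
        have : ((β : ℕ) : ℝ) = (β' : ℕ) + q ^ 2 * s := by
          simp only [Int.cast_zero, mul_zero, zero_add] at hb
          field_simp at hb
          linear_combination hb
        exact_mod_cast this
      have hβ₁ := eq_of_eq_add_mul β.2 β'.2 hβ
      have hμ : ((μ : ℕ) : ℤ) = (μ' : ℕ) + q * t := by
        have : ((μ : ℕ) : ℝ) = (μ' : ℕ) + q * t := by
          simp only [Int.cast_zero, mul_zero, zero_add, add_zero] at hm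
          rw [hi₁, hβ₁] at hm
          linear_combination hm
        exact_mod_cast this
      have hμ₁ := eq_of_eq_add_mul μ.2 μ'.2 hμ
      rw [Fin.ext hi₁, Fin.ext hβ₁, Fin.ext hμ₁]
  obtain ⟨rfl, hk⟩ := key
  have hj' : (ofInt N 1 b 0 1 0 m κ 1 hdet).toSp2 = (transl b m (κ / N)).toSp2 := by
    congr 1
    ext <;> simp [ofInt, transl]
  refine ⟨mem_translationGroup_iff.2 ⟨b, m, κ, hj'⟩, fun h1 => ?_⟩
  have h2 := congrArg (fun M : Sp2 => M.1 (.inl 0) (.inr 0)) h1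
  have h3 := congrArg (fun M : Sp2 => M.1 (.inl 1) (.inr 0)) h1
  simp [toSp2, ofInt] at h2 h3
  exact hk h2 h3

theorem mul_mem_doubleCoset {Γ : Subgroup Sp2} {K : Sp2} {j L : Sp2} (hj : j ∈ Γ)
    (hL : L ∈ doubleCoset Γ K) : j * L ∈ doubleCoset Γ K := by
  obtain ⟨x, hx, y, hy, rfl⟩ := DoubleCoset.mem_doubleCoset.1 hL
  exact DoubleCoset.mem_doubleCoset.2 ⟨j * x, mul_mem hj hx, y, hy, by simp [mul_assoc]⟩

theorem mem_doubleCoset_mul {Γ : Subgroup Sp2} {K : Sp2} {j L : Sp2} (hj : j ∈ Γ)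
    (hL : L ∈ doubleCoset Γ K) : L * j ∈ doubleCoset Γ K := by
  obtain ⟨x, hx, y, hy, rfl⟩ := DoubleCoset.mem_doubleCoset.1 hL
  exact DoubleCoset.mem_doubleCoset.2 ⟨x, hx, y * j, mul_mem hy hj, by simp [mul_assoc]⟩

theorem isTransversal_heckeRep (N : ℕ) [NeZero N] {q : ℕ} (hq : q.Prime) {ι : Type*}
    {u : ι → Sp2} (hu : IsTransversal (translationGroup N) (jacobiGroup N : Set Sp2) u) :
    IsTransversal (translationGroup N) (doubleCoset (jacobiGroup N) (heckeMatrix q hq.ne_zero))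
      (fun x : HeckeIndex q × ι => (heckeRep q hq.ne_zero x.1).toSp2 * u x.2) where
  mem x := mem_doubleCoset_mul (hu.mem x.2) (heckeRep_mem hq x.1)
  surj L hL := by
    obtain ⟨x, hx, y, hy, rfl⟩ := DoubleCoset.mem_doubleCoset.1 hL
    obtain ⟨r, γ, hγ, j, hj, h⟩ := exists_heckeRep_of_jacobiGroup hq hx
    obtain ⟨i, δ, hδ, hi⟩ := hu.surj (j * y) (mul_mem hj hy)
    obtain ⟨r', η, hη, hr⟩ := exists_heckeRep_mul_translation hq.ne_zero r hδ
    refine ⟨(r', i), γ * η, mul_mem hγ hη, ?_⟩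
    rw [h, mul_assoc, mul_assoc _ j, hi, ← mul_assoc _ δ, hr, mul_assoc, mul_assoc]
  inj := by
    rintro ⟨r, i⟩ ⟨r', i'⟩ γ hγ h
    dsimp only at h
    have h' : (heckeRep q hq.ne_zero r).toSp2 =
        γ * ((heckeRep q hq.ne_zero r').toSp2 * (u i' * (u i)⁻¹)) := by
      rw [← mul_assoc _ (u i'), ← mul_assoc γ, ← h, mul_inv_cancel_right]
    obtain ⟨h1, h2⟩ := heckeRep_eq_mul hq hγ (mul_mem (hu.mem i') (inv_mem (hu.mem i))) h'
    have hi : i' = i := hu.inj i' i _ h1 (by rw [inv_mul_cancel_right])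
    subst hi
    rw [h2 (mul_inv_cancel _)]

/-! ### The Hecke eigenvalue -/

theorem slash_phi_dil (k : ℤ) (N : ℕ) {q : ℕ} (hq : (q : ℝ) ≠ 0)
    {Z : Matrix (Fin 2) (Fin 2) ℂ} (hZ : Z ∈ upperLeftHalfSpace) :
    slash k (phi N) (dil q hq).toSp2 Z = (q : ℂ) ^ k * phi N Z := by
  rw [slash_phi _ _ _ hZ]
  simp [dil, denom, phi]

/-- The additive character `x ↦ exp(2πix)`. -/
def expTwoPiI (x : ℂ) : ℂ := Complex.exp (2 * Real.pi * Complex.I * x)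

/-- φ_N acted on by the Heisenberg element is e(N(τ' + 2lz + l²τ)), and the remaining factor only
shifts τ by s. -/
theorem slash_phi_unip (k : ℤ) (N : ℕ) (l s : ℝ) {Z : Matrix (Fin 2) (Fin 2) ℂ}
    (hZ : Z ∈ upperLeftHalfSpace) : slash k (phi N) (unip l s).toSp2 Z =
      expTwoPiI (N * l ^ 2 * s) * slash k (phi N) (heis l).toSp2 Z := by
  rw [slash_phi _ _ _ hZ, slash_phi _ _ _ hZ]
  simp only [unip, heis, denom, expTwoPiI]
  simp [← Complex.exp_add]
  congr 1
  ring

/-- The case s = u = 0 gives q^(-k) e(N(τ' + 2lz/q + l²τ/q²)), and the translation on the right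
shifts τ by s and z by u. -/
theorem slash_phi_contraction (k : ℤ) (N : ℕ) {q : ℝ} (hq : q ≠ 0) (l s u : ℝ)
    {Z : Matrix (Fin 2) (Fin 2) ℂ} (hZ : Z ∈ upperLeftHalfSpace) :
    slash k (phi N) (contraction q hq l s u).toSp2 Z =
      expTwoPiI (N * l ^ 2 / q ^ 2 * s) *
        (expTwoPiI (2 * N * l * u / q) * slash k (phi N) (contraction q hq l 0 0).toSp2 Z) := by
  have hq' : (q : ℂ) ≠ 0 := Complex.ofReal_ne_zero.2 hq
  rw [slash_phi _ _ _ hZ, slash_phi _ _ _ hZ]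
  simp only [contraction, denom, expTwoPiI]
  rw [mul_left_comm _ (_ ^ _), mul_left_comm _ (_ ^ _), ← Complex.exp_add, ← Complex.exp_add]
  simp
  left
  congr 1
  field_simp
  ring

theorem slash_phi_contraction_zero (k : ℤ) (N : ℕ) {q : ℝ} (hq : q ≠ 0)
    {Z : Matrix (Fin 2) (Fin 2) ℂ} (hZ : Z ∈ upperLeftHalfSpace) :
    slash k (phi N) (contraction q hq 0 0 0).toSp2 Z = (q : ℂ) ^ (-k) * phi N Z := by
  rw [slash_phi _ _ _ hZ]
  simp [contraction, denom, phi]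

theorem sum_expTwoPiI (n : ℕ) (hn : n ≠ 0) (t : ℤ) :
    ∑ i : Fin n, expTwoPiI (t / n * (i : ℕ)) = if (n : ℤ) ∣ t then (n : ℂ) else 0 := by
  have hn' : (n : ℂ) ≠ 0 := Nat.cast_ne_zero.2 hn
  have hpow : ∀ i : ℕ, expTwoPiI (t / n * i) = expTwoPiI (t / n) ^ i := fun i => by
    rw [expTwoPiI, expTwoPiI, ← Complex.exp_nat_mul]
    congr 1
    ring
  rw [Fin.sum_univ_eq_sum_range (fun i => expTwoPiI (t / n * i)) n]
  simp only [hpow]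
  split_ifs with h
  · obtain ⟨e, rfl⟩ := h
    have : expTwoPiI ((n * e : ℤ) / n) = 1 := by
      rw [expTwoPiI, Complex.exp_eq_one_iff]
      exact ⟨e, by push_cast; field_simp⟩
    simp only [this, one_pow, Finset.sum_const, Finset.card_range, nsmul_eq_mul, mul_one]
  · have h1 : expTwoPiI (t / n) ≠ 1 := by
      rw [expTwoPiI, Ne, Complex.exp_eq_one_iff]
      rintro ⟨e, he⟩
      apply h
      refine ⟨e, ?_⟩
      have h2 : (t / n : ℂ) = e := by
        refine mul_left_cancel₀ Complex.two_pi_I_ne_zero ?_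
        rw [he, mul_comm]
      rw [div_eq_iff hn'] at h2
      have h3 : (t : ℂ) = ((n * e : ℤ) : ℂ) := by rw [h2]; push_cast; ring
      exact_mod_cast h3
    rw [geom_sum_eq h1, ← hpow, div_mul_cancel₀ _ hn']
    simp [expTwoPiI, show (2 * Real.pi * Complex.I * t : ℂ) = t * (2 * Real.pi * Complex.I) by ring,
      Complex.exp_int_mul_two_pi_mul_I]

/-! ### Invariance of the series and unfolding of the Hecke operator -/

theorem slash_jacobiEisenstein_toSp2 (k : ℤ) (N : ℕ) [NeZero N] (Q : JacobiElt)
    {Z : Matrix (Fin 2) (Fin 2) ℂ} (hZ : Z ∈ upperLeftHalfSpace) :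
    slash k (jacobiEisenstein k N) Q.toSp2 Z =
      1 / 4 * ∑' c : CosetSpace (translationGroup N) (jacobiGroup N),
        slash k (phi N) (c.rep * Q.toSp2) Z := by
  have hT := isTransversal_rep (translationGroup N) (jacobiGroup N : Set Sp2)
  rw [slash, jacobiEisenstein, mul_left_comm, ← tsum_mul_left]
  congr 1
  refine tsum_congr fun c => ?_
  obtain ⟨P, hP⟩ := exists_toSp2_of_mem_jacobiGroup (hT.mem c)
  rw [hP, slash_toSp2_mul _ _ _ _ hZ]
  rfl

theorem slash_jacobiEisenstein (k : ℤ) (N : ℕ) [NeZero N] {M : Sp2} (hM : M ∈ jacobiGroup N)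
    {Z : Matrix (Fin 2) (Fin 2) ℂ} (hZ : Z ∈ upperLeftHalfSpace) :
    slash k (jacobiEisenstein k N) M Z = jacobiEisenstein k N Z := by
  have hT := isTransversal_rep (translationGroup N) (jacobiGroup N : Set Sp2)
  obtain ⟨Q, rfl⟩ := exists_toSp2_of_mem_jacobiGroup hM
  rw [slash_jacobiEisenstein_toSp2 k N Q hZ, jacobiEisenstein,
    ((hT.mul_right hM).summable_iff_and_tsum_eq hT (F := fun L => slash k (phi N) L Z)
      (slash_phi_invariant k N hZ)).2]

theorem exists_toSp2_of_mem_doubleCoset {N : ℕ} [NeZero N] {q : ℕ} (hq : q ≠ 0) {L : Sp2}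
    (hL : L ∈ doubleCoset (jacobiGroup N) (heckeMatrix q hq)) :
    ∃ P : JacobiElt, L = P.toSp2 := by
  obtain ⟨x, hx, y, hy, rfl⟩ := DoubleCoset.mem_doubleCoset.1 hL
  obtain ⟨P, rfl⟩ := exists_toSp2_of_mem_jacobiGroup hx
  obtain ⟨Q, rfl⟩ := exists_toSp2_of_mem_jacobiGroup hy
  exact ⟨_, by rw [heckeMatrix_eq, ← toSp2_mul, ← toSp2_mul]⟩

theorem summable_slash_rep_mul {k : ℤ} (hk : 4 ≤ k) (N : ℕ) [NeZero N] (Q : JacobiElt)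
    {Z : Matrix (Fin 2) (Fin 2) ℂ} (hZ : Z ∈ upperLeftHalfSpace) :
    Summable fun c : CosetSpace (translationGroup N) (jacobiGroup N) =>
      slash k (phi N) (c.rep * Q.toSp2) Z := by
  have hT := isTransversal_rep (translationGroup N) (jacobiGroup N : Set Sp2)
  refine ((summable_slash_rep hk N (Q.moebius_mem hZ)).mul_left
    ((blockC Q.toSp2 * Z + blockD Q.toSp2).det ^ (-k))).congr fun c => ?_
  obtain ⟨P, hP⟩ := exists_toSp2_of_mem_jacobiGroup (hT.mem c)
  rw [hP, slash_toSp2_mul _ _ _ _ hZ]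
  rfl

/-- The Hecke operator of the Eisenstein series as a sum over `heckeRep`. -/
theorem heckeOperator_jacobiEisenstein {k : ℤ} (hk : 4 ≤ k) (N : ℕ) [NeZero N] {q : ℕ}
    (hq : q.Prime) {Z : Matrix (Fin 2) (Fin 2) ℂ} (hZ : Z ∈ upperLeftHalfSpace) :
    heckeOperator k (jacobiGroup N) (heckeMatrix q hq.ne_zero) (jacobiEisenstein k N) Z =
      1 / 4 * ∑ r : HeckeIndex q, ∑' c : CosetSpace (translationGroup N) (jacobiGroup N),
        slash k (phi N) ((heckeRep q hq.ne_zero r).toSp2 * c.rep) Z := by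
  set S := doubleCoset (jacobiGroup N) (heckeMatrix q hq.ne_zero) with hS
  have : Finite (CosetSpace (jacobiGroup N) S) := finite_cosetSpace_heckeMatrix N q hq.ne_zero
  have := Fintype.ofFinite (CosetSpace (jacobiGroup N) S)
  have hT := isTransversal_rep (translationGroup N) (jacobiGroup N : Set Sp2)
  have hT₁ := isTransversal_rep (jacobiGroup N) S
  -- `hT₂` and `hT₃` are two transversals of Γ\JKJ: the first has the Jacobi cosets on the left, the
  -- second on the right.
  have hT₂ := hT.mul (translationGroup_le_jacobiGroup N) (S := S)
    (fun j hj L hL => mul_mem_doubleCoset hj hL) hT₁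
  have hT₃ := isTransversal_heckeRep N hq hT
  have hF : ∀ γ ∈ translationGroup N, ∀ L ∈ S,
      slash k (phi N) (γ * L) Z = slash k (phi N) L Z := fun γ hγ L hL => by
    obtain ⟨P, rfl⟩ := exists_toSp2_of_mem_doubleCoset hq.ne_zero hL
    exact slash_phi_translation_mul k N hγ P hZ
  have hrow : ∀ c : CosetSpace (jacobiGroup N) S, Summable
      fun y : CosetSpace (translationGroup N) (jacobiGroup N) =>
        slash k (phi N) (y.rep * c.rep) Z := fun c => by
    obtain ⟨Q, hQ⟩ := exists_toSp2_of_mem_doubleCoset hq.ne_zero (hT₁.mem c)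
    rw [hQ]
    exact summable_slash_rep_mul hk N Q hZ
  have hsum : Summable fun x : CosetSpace (jacobiGroup N) S ×
      CosetSpace (translationGroup N) (jacobiGroup N) =>
        slash k (phi N) (x.2.rep * x.1.rep) Z :=
    Summable.of_norm ((summable_prod_of_nonneg fun _ => norm_nonneg _).2
      ⟨fun c => (hrow c).norm, (hasSum_fintype _).summable⟩)
  obtain ⟨h1, h2⟩ := hT₂.summable_iff_and_tsum_eq hT₃ (F := fun L => slash k (phi N) L Z) hF
  rw [heckeOperator, finsum_eq_sum_of_fintype]
  have hterm : ∀ c : CosetSpace (jacobiGroup N) S, slash k (jacobiEisenstein k N) c.rep Z =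
      1 / 4 * ∑' y : CosetSpace (translationGroup N) (jacobiGroup N),
        slash k (phi N) (y.rep * c.rep) Z := fun c => by
    obtain ⟨Q, hQ⟩ := exists_toSp2_of_mem_doubleCoset hq.ne_zero (hT₁.mem c)
    rw [hQ]
    exact slash_jacobiEisenstein_toSp2 k N Q hZ
  rw [Finset.sum_congr rfl fun c _ => hterm c, ← Finset.mul_sum]
  congr 1
  have h3 := (h1.1 hsum).tsum_prod
  rw [← h2, hsum.tsum_prod] at h3
  rwa [tsum_fintype, tsum_fintype] at h3

theorem tsum_slash_mul_of_slash_eq (k : ℤ) (N : ℕ) [NeZero N] {P Q : JacobiElt} {t : ℂ}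
    (h : ∀ Z ∈ upperLeftHalfSpace,
      slash k (phi N) P.toSp2 Z = t * slash k (phi N) Q.toSp2 Z)
    {Z : Matrix (Fin 2) (Fin 2) ℂ} (hZ : Z ∈ upperLeftHalfSpace) :
    ∑' c : CosetSpace (translationGroup N) (jacobiGroup N),
        slash k (phi N) (P.toSp2 * c.rep) Z =
      t * ∑' c : CosetSpace (translationGroup N) (jacobiGroup N),
        slash k (phi N) (Q.toSp2 * c.rep) Z := by
  rw [← tsum_mul_left]
  refine tsum_congr fun c => ?_
  obtain ⟨R, hR⟩ := exists_toSp2_of_mem_jacobiGroup ((isTransversal_rep _ _).mem c)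
  rw [hR, slash_toSp2_mul _ _ _ _ hZ, slash_toSp2_mul _ _ _ _ hZ, slash_congr R k h hZ,
    slash_const_mul]

theorem heis_zero : (heis 0).toSp2 = 1 := by
  apply Subtype.ext
  ext i j
  rcases i with i | i <;> rcases j with j | j <;> fin_cases i <;> fin_cases j <;>
    simp [toSp2, heis]

theorem heis_mul_translation {N : ℕ} [NeZero N] (l : ℤ) {γ : Sp2}
    (hγ : γ ∈ translationGroup N) : ∃ δ ∈ translationGroup N,
      (heis l).toSp2 * γ = δ * (heis l).toSp2 := by
  have hN : (N : ℝ) ≠ 0 := Nat.cast_ne_zero.2 (NeZero.ne N)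
  obtain ⟨s, t, u, rfl⟩ := mem_translationGroup_iff.1 hγ
  refine ⟨_, mem_translationGroup_iff.2
    ⟨s, t + l * s, u + N * (2 * l * t + l ^ 2 * s), rfl⟩, ?_⟩
  rw [← toSp2_mul, ← toSp2_mul]
  congr 1
  ext <;> simp [mul_def, transl, heis] <;> field_simp <;> ring

/-- An integral Heisenberg element lies in J and normalizes Γ, so it permutes Γ\J from the left.
Hence φ_N acted on by it generates the same Eisenstein series. -/
theorem tsum_slash_heis_mul (k : ℤ) (N : ℕ) [NeZero N] (l : ℤ)
    {Z : Matrix (Fin 2) (Fin 2) ℂ} (hZ : Z ∈ upperLeftHalfSpace) :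
    ∑' c : CosetSpace (translationGroup N) (jacobiGroup N),
        slash k (phi N) ((heis l).toSp2 * c.rep) Z =
      ∑' c : CosetSpace (translationGroup N) (jacobiGroup N), slash k (phi N) c.rep Z := by
  have hT := isTransversal_rep (translationGroup N) (jacobiGroup N : Set Sp2)
  have hmem : (heis l).toSp2 ∈ jacobiGroup N := mem_jacobiGroup_iff.2
    ⟨1, 0, 0, 1, l, 0, 0, 1, by ring, by congr 1; ext <;> simp [heis, ofInt]⟩
  have hinv : (heis (-l : ℤ)).toSp2 = (heis l).toSp2⁻¹ := by
    refine eq_inv_of_mul_eq_one_left ?_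
    rw [← toSp2_mul, ← heis_zero]
    congr 1
    ext <;> simp [mul_def, heis]
  refine ((hT.mul_left hmem (fun γ hγ => ?_) fun γ hγ => ?_).summable_iff_and_tsum_eq hT
    (F := fun L => slash k (phi N) L Z) (slash_phi_invariant k N hZ)).2
  · obtain ⟨δ, hδ, h⟩ := heis_mul_translation l hγ
    rwa [h, mul_inv_cancel_right]
  · obtain ⟨δ, hδ, h⟩ := heis_mul_translation (-l) hγ
    rw [hinv] at h
    rwa [h, inv_mul_cancel_right]

theorem dvd_mul_sq_iff {N q : ℕ} (hq : q.Prime) (hqN : ¬ q ∣ N) (l : Fin q) :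
    (q : ℤ) ∣ (N * (l : ℕ) ^ 2 : ℕ) ↔ l = ⟨0, hq.pos⟩ := by
  rw [Int.natCast_dvd_natCast]
  constructor
  · intro h
    have h1 := hq.dvd_of_dvd_pow ((hq.dvd_mul.1 h).resolve_left hqN)
    exact Fin.ext (Nat.eq_zero_of_dvd_of_lt h1 l.2)
  · rintro rfl
    simp

/-- For fixed l the full sum over s mod q is q if l = 0 and 0 otherwise. Removing s = 0 subtracts 1
for each of the q values of l, and q - q = 0. -/
theorem sum_unip_eq_zero {N q : ℕ} (hq : q.Prime) (hqN : ¬ q ∣ N) :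
    ∑ x : Fin (q - 1) × Fin q,
      expTwoPiI (N * ((x.2 : ℕ) : ℂ) ^ 2 * (((x.1 : ℕ) + 1 : ℕ) / q)) = 0 := by
  obtain ⟨n, rfl⟩ : ∃ n, q = n + 1 := ⟨q - 1, by have := hq.pos; omega⟩
  have hrow : ∀ l : Fin (n + 1), ∑ s : Fin (n + 1 - 1),
      expTwoPiI (N * ((l : ℕ) : ℂ) ^ 2 * (((s : ℕ) + 1 : ℕ) / (n + 1 : ℕ))) =
        (if l = ⟨0, hq.pos⟩ then ((n + 1 : ℕ) : ℂ) else 0) - 1 := fun l => by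
    have h := sum_expTwoPiI (n + 1) hq.ne_zero (N * (l : ℕ) ^ 2 : ℕ)
    simp only [dvd_mul_sq_iff hq hqN l] at h
    rw [← h, Fin.sum_univ_succ, eq_sub_iff_add_eq, add_comm]
    congr 1
    · simp [expTwoPiI]
    · refine Finset.sum_congr rfl fun s _ => ?_
      congr 1
      push_cast [Fin.val_succ]
      ring
  rw [Fintype.sum_prod_type_right]
  dsimp only
  rw [Finset.sum_congr rfl fun l _ => hrow l, Finset.sum_sub_distrib]
  simp

theorem sum_contraction {N q : ℕ} (hq : q.Prime) (hqN : ¬ q ∣ N) (G : Fin q → ℂ) :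
    ∑ x : Fin q × Fin (q ^ 2) × Fin q,
      expTwoPiI (N * ((x.1 : ℕ) : ℂ) ^ 2 / q ^ 2 * (x.2.1 : ℕ)) *
        (expTwoPiI (2 * N * (x.1 : ℕ) * (x.2.2 : ℕ) / q) * G x.1) =
      q ^ 3 * G ⟨0, hq.pos⟩ := by
  simp only [Fintype.sum_prod_type]
  rw [Finset.sum_eq_single ⟨0, hq.pos⟩]
  · simp [expTwoPiI]
    ring
  · intro l _ hl
    have hcond : ¬ ((q ^ 2 : ℕ) : ℤ) ∣ (N * (l : ℕ) ^ 2 : ℕ) := fun h => by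
      refine hl ((dvd_mul_sq_iff hq hqN l).1 (dvd_trans ?_ h))
      exact Int.natCast_dvd_natCast.2 (dvd_pow_self q two_ne_zero)
    have h := sum_expTwoPiI (q ^ 2) (pow_ne_zero 2 hq.ne_zero) (N * (l : ℕ) ^ 2 : ℕ)
    rw [if_neg hcond] at h
    push_cast at h
    rw [Finset.sum_congr rfl fun s _ => (Finset.mul_sum _ _ _).symm, ← Finset.sum_mul, h, zero_mul]
  · simp

theorem heckeOperator_eigenvalue {k : ℤ} (hk : 4 ≤ k) (N : ℕ) [NeZero N] {q : ℕ}
    (hq : q.Prime) (hqN : ¬ q ∣ N) {Z : Matrix (Fin 2) (Fin 2) ℂ}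
    (hZ : Z ∈ upperLeftHalfSpace) :
    heckeOperator k (jacobiGroup N) (heckeMatrix q hq.ne_zero) (jacobiEisenstein k N) Z =
      ((q : ℂ) ^ k + (q : ℂ) ^ (3 - k)) * jacobiEisenstein k N Z := by
  have hq0 : (q : ℝ) ≠ 0 := Nat.cast_ne_zero.2 hq.ne_zero
  have hqC : (q : ℂ) ≠ 0 := Nat.cast_ne_zero.2 hq.ne_zero
  rw [heckeOperator_jacobiEisenstein hk N hq hZ, jacobiEisenstein]
  set E := ∑' c : CosetSpace (translationGroup N) (jacobiGroup N), slash k (phi N) c.rep Z with hE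
  have hphi : ∀ W ∈ upperLeftHalfSpace, slash k (phi N) (heis (0 : ℤ)).toSp2 W = phi N W :=
    fun W hW => by
      rw [slash_phi _ _ _ hW]
      simp [heis, denom, phi]
  have hdil : ∀ a : Unit, ∑' c : CosetSpace (translationGroup N) (jacobiGroup N),
      slash k (phi N) ((heckeRep q hq.ne_zero (.inl a)).toSp2 * c.rep) Z = (q : ℂ) ^ k * E :=
    fun _ => by
      rw [hE, ← tsum_slash_heis_mul k N 0 hZ]
      exact tsum_slash_mul_of_slash_eq k N
        (fun W hW => by rw [hphi W hW]; exact slash_phi_dil k N hq0 hW) hZ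
  have hunip : ∀ x : Fin (q - 1) × Fin q,
      ∑' c : CosetSpace (translationGroup N) (jacobiGroup N),
        slash k (phi N) ((heckeRep q hq.ne_zero (.inr (.inl x))).toSp2 * c.rep) Z =
      expTwoPiI (N * ((x.2 : ℕ) : ℂ) ^ 2 * (((x.1 : ℕ) + 1 : ℕ) / q)) * E := fun x => by
    rw [hE, ← tsum_slash_heis_mul k N (x.2 : ℕ) hZ]
    refine tsum_slash_mul_of_slash_eq k N (fun W hW => ?_) hZ
    refine (slash_phi_unip k N _ _ hW).trans ?_
    push_cast
    rfl
  -- For l ≠ 0 these sums need not be evaluated: their coefficient in `sum_contraction` vanishes.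
  set G : Fin q → ℂ := fun l => ∑' c : CosetSpace (translationGroup N) (jacobiGroup N),
    slash k (phi N) ((contraction q hq0 (l : ℕ) 0 0).toSp2 * c.rep) Z with hG
  have hcontr : ∀ x : Fin q × Fin (q ^ 2) × Fin q,
      ∑' c : CosetSpace (translationGroup N) (jacobiGroup N),
        slash k (phi N) ((heckeRep q hq.ne_zero (.inr (.inr x))).toSp2 * c.rep) Z =
      expTwoPiI (N * ((x.1 : ℕ) : ℂ) ^ 2 / q ^ 2 * (x.2.1 : ℕ)) *
        (expTwoPiI (2 * N * (x.1 : ℕ) * (x.2.2 : ℕ) / q) * G x.1) := fun x => by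
    rw [← mul_assoc]
    refine tsum_slash_mul_of_slash_eq k N (fun W hW => ?_) hZ
    refine (slash_phi_contraction k N hq0 _ _ _ hW).trans ?_
    rw [← mul_assoc]
    push_cast
    rfl
  have hG0 : G ⟨0, hq.pos⟩ = (q : ℂ) ^ (-k) * E := by
    rw [hE, ← tsum_slash_heis_mul k N 0 hZ]
    refine tsum_slash_mul_of_slash_eq k N (fun W hW => ?_) hZ
    rw [hphi W hW]
    simpa using slash_phi_contraction_zero k N hq0 hW
  rw [Fintype.sum_sum_type, Fintype.sum_sum_type, Fintype.sum_unique]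
  simp only [hdil, hunip, hcontr]
  rw [← Finset.sum_mul, sum_unip_eq_zero hq hqN, sum_contraction hq hqN G, hG0,
    sub_eq_add_neg, zpow_add₀ hqC]
  simp
  ring

end Paramodular

end

theorem corollary5 (k : ℤ) (hk : 4 ≤ k) (hk_even : Even k) (N : ℕ) [NeZero N]
    (hN : Squarefree N) (q : ℕ) (hq : q.Prime) (hqN : ¬ q ∣ N) :
    (∀ Z ∈ siegelHalfSpace,
      Summable fun c : CosetSpace (translationGroup N) (jacobiGroup N) =>
        slash k (phi N) c.rep Z) ∧
    (∀ M ∈ jacobiGroup N, ∀ Z ∈ siegelHalfSpace,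
      slash k (jacobiEisenstein k N) M Z = jacobiEisenstein k N Z) ∧
    (∃ Z ∈ siegelHalfSpace, jacobiEisenstein k N Z ≠ 0) ∧
    Finite (CosetSpace (jacobiGroup N)
      (doubleCoset (jacobiGroup N) (heckeMatrix q hq.ne_zero))) ∧
    ∀ Z ∈ siegelHalfSpace,
      heckeOperator k (jacobiGroup N) (heckeMatrix q hq.ne_zero) (jacobiEisenstein k N) Z =
        ((q : ℂ) ^ k + (q : ℂ) ^ (3 - k)) * jacobiEisenstein k N Z :=
  ⟨fun _ hZ => summable_slash_rep hk N (siegelHalfSpace_subset hZ),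
    fun _ hM _ hZ => slash_jacobiEisenstein k N hM (siegelHalfSpace_subset hZ),
    exists_jacobiEisenstein_ne_zero hk hk_even N,
    finite_cosetSpace_heckeMatrix N q hq.ne_zero,
    fun _ hZ => heckeOperator_eigenvalue hk N hq hqN (siegelHalfSpace_subset hZ)⟩
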